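/- Let $\mathbb H_2$ be the upper half-plane with its hyperbolic metric, and let $G$ be the group of transformations $z\mapsto az+b$ of $\mathbb H_2$ with $a>0$, $b\in\mathbb R$, equipped with the left-invariant metric $d(g,h)=d_{\mathbb H_2}(g\cdot i,h\cdot i)$. Put $R:z\mapsto 2z$ and $S:z\mapsto z+1$. Let $P$ be the convex hyperbolic pentagon with vertices $i,\ \tfrac12+i,\ 1+i,\ 1+2i,\ 2i$, and let $\mathcal P=\{R^kS^nP : k,n\in\mathbb Z\}$ be the hyperbolic Penrose tiling. Collections of tiles carry the tiling topology, generated by $$\delta(T,T')=\inf\Big(\big\{\tfrac1{\sqrt2}\big\}\cup\big\{\varepsilon\in(0,\tfrac1{\sqrt2}] : \exists g\in G,\ d(g,\mathrm{Id})<\varepsilon,\ gT\cap B_{1/\varepsilon}=T'\cap B_{1/\varepsilon}\big\}\Big),$$ where $B_\rho$ is the open ball of radius $\rho$ around $i$ and $T\cap B_\rho$ is the set of tiles of $T$ that meet $B_\rho$. Let $X^{\mathcal N}_{\mathcal P}$ be the closure of $\{\mathcal P+s : s\in\mathbb R\}$ in this topology. The group $\mathbb R$ acts on it by translations $T\mapsto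 T+s$, and $R$ acts on it by $T\mapsto R.T$. (This $\mathbb R$-action is conjugate to the suspension of the dyadic odometer.) Let $r\ge 1$, let $w\in\{1,\dots,r\}^{\mathbb Z}$, let $\sigma$ be the shift $(w_n)_n\mapsto(w_{n+1})_n$, and let $Z_w=\overline{\{\sigma^n(w):n\in\mathbb Z\}}$. On $X^{\mathcal N}_{\mathcal P}\times Z_w\times\mathbb R^*_+$ with the product topology let $\mathcal R(T,w',t)=(R.T,\sigma(w'),t/2)$, and let $g:z\mapsto az+b$ in $G$ act by $g.(T,w',t)=(T+\tfrac{b}{at},w',at)$. This action commutes with $\mathcal R$ and hence induces an action of $G$ on the double suspension $(X^{\mathcal N}_{\mathcal P}\times Z_w\times\mathbb R^*_+)/\mathcal R$, the quotient by the orbits of $\mathcal R$. Let $\pi$ denote the projection onto this quotient, and let $m$ be a Haar measure of the multiplicative group $\mathbb R^*_+$. All measures are Borel measures. **Proposition.** There is exactly one translation-invariant probability measure $\nu$ on $X^{\mathcal N}_{\mathcal P}$. For every finite $G$-invariant measure $\theta$ on $(X^{\mathcal N}_{\mathcal P}\times Z_w\times\mathbb R^*_+)/\mathcal R$ there is a finite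 $\sigma$-invariant measure $\mu$ on $Z_w$ such that $\theta$ is locally the image of $\nu\otimes\mu\otimes m$ through $\pi$: every point of $X^{\mathcal N}_{\mathcal P}\times Z_w\times\mathbb R^*_+$ has an open neighbourhood $U$ which $\pi$ maps homeomorphically onto an open set, and $$\theta|_{\pi(U)}=\pi_*\big((\nu\otimes\mu\otimes m)|_U\big).$$ -/

import Mathlib

open MeasureTheory Topology TopologicalSpace
open scoped UpperHalfPlane

namespace HypPenrose

noncomputable section

/-- The multiplicative group `ℝ*₊`. -/
abbrev PosReal : Type := {x : ℝ // 0 < x}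

/-! ### The group `G` of affine transformations `z ↦ a z + b`, `a > 0`, of the half-plane -/

/-- The element `⟨a, b⟩` stands for `z ↦ a z + b`. -/
@[ext]
structure AffGroup where
  a : PosReal
  b : ℝ

namespace AffGroup

/-- Composition of transformations: `a (a' z + b') + b = (a a') z + (a b' + b)`. -/
instance : Group AffGroup where
  mul g h := ⟨g.a * h.a, g.a * h.b + g.b⟩
  one := ⟨1, 0⟩
  inv g := ⟨g.a⁻¹, -((g.a⁻¹ : PosReal) : ℝ) * g.b⟩
  mul_assoc g h k := by
    apply AffGroup.ext
    · exact mul_assoc g.a h.a k.a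
    · change ((g.a * h.a : PosReal) : ℝ) * k.b + (g.a * h.b + g.b)
        = g.a * (h.a * k.b + h.b) + g.b
      rw [Positive.val_mul]
      ring
  one_mul g := by
    apply AffGroup.ext
    · exact one_mul g.a
    · change ((1 : PosReal) : ℝ) * g.b + 0 = g.b
      simp
  mul_one g := by
    apply AffGroup.ext
    · exact mul_one g.a
    · change (g.a : ℝ) * 0 + g.b = g.b
      simp
  inv_mul_cancel g := by
    apply AffGroup.ext
    · exact inv_mul_cancel g.a
    · change ((g.a⁻¹ : PosReal) : ℝ) * g.b + -((g.a⁻¹ : PosReal) : ℝ) * g.b = 0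
      ring

theorem mul_a (g h : AffGroup) : (g * h).a = g.a * h.a := rfl
theorem mul_b (g h : AffGroup) : (g * h).b = g.a * h.b + g.b := rfl
theorem one_a : (1 : AffGroup).a = 1 := rfl
theorem one_b : (1 : AffGroup).b = 0 := rfl
theorem inv_a (g : AffGroup) : (g⁻¹).a = g.a⁻¹ := rfl

/-- `G` acts on the upper half-plane by `z ↦ a z + b`. -/
instance : MulAction AffGroup ℍ where
  smul g z := g.b +ᵥ (g.a • z)
  one_smul z := by
    change (0 : ℝ) +ᵥ ((1 : PosReal) • z) = z
    simp
  mul_smul g h z := by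
    change (g.a * h.b + g.b : ℝ) +ᵥ ((g.a * h.a : PosReal) • z)
      = g.b +ᵥ (g.a • (h.b +ᵥ (h.a • z)))
    apply UpperHalfPlane.ext
    simp only [UpperHalfPlane.coe_vadd, UpperHalfPlane.coe_pos_real_smul, Complex.real_smul,
      Positive.val_mul]
    push_cast
    ring

theorem smul_def (g : AffGroup) (z : ℍ) : g • z = g.b +ᵥ (g.a • z) := rfl

theorem isometry_smul (g : AffGroup) : Isometry (fun z : ℍ => g • z) :=
  (UpperHalfPlane.isometry_real_vadd g.b).comp (UpperHalfPlane.isometry_pos_mul g.a)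

/-- The translation `z ↦ z + s`; these form the subgroup `𝒩 ≅ ℝ`. -/
def translation (s : ℝ) : AffGroup := ⟨1, s⟩

/-- `R : z ↦ 2 z`. -/
def R : AffGroup := ⟨⟨2, two_pos⟩, 0⟩

/-- `S : z ↦ z + 1`. -/
def S : AffGroup := translation 1

theorem translation_zero : translation 0 = 1 := rfl

theorem translation_add (s t : ℝ) : translation (s + t) = translation s * translation t := by
  apply AffGroup.ext
  · simp [translation, mul_a]
  · simp [translation, mul_b, add_comm]

theorem R_mul_translation (s : ℝ) : R * translation s = translation (2 * s) * R := by
  apply AffGroup.ext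
  · simp [translation, mul_a]
  · simp [translation, mul_b, R]

theorem R_inv_mul_translation (s : ℝ) : R⁻¹ * translation s = translation (s / 2) * R⁻¹ := by
  rw [inv_mul_eq_iff_eq_mul, ← mul_assoc, R_mul_translation]
  simp [mul_assoc, mul_div_cancel₀]

end AffGroup

/-! ### Collections of tiles and the tiling topology -/

/-- A collection of tiles, each tile being a nonempty compact subset of the half-plane. -/
@[ext]
structure TileSet where
  tiles : Set (NonemptyCompacts ℍ)

/-- The image of a tile under an element of `G`. -/
def tileImage (g : AffGroup) (K : NonemptyCompacts ℍ) : NonemptyCompacts ℍ :=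
  K.map (fun z => g • z) g.isometry_smul.continuous

theorem coe_tileImage (g : AffGroup) (K : NonemptyCompacts ℍ) :
    (tileImage g K : Set ℍ) = (fun z => g • z) '' K := rfl

theorem tileImage_one (K : NonemptyCompacts ℍ) : tileImage 1 K = K := by
  apply SetLike.coe_injective
  simp [coe_tileImage]

theorem tileImage_mul (g h : AffGroup) (K : NonemptyCompacts ℍ) :
    tileImage (g * h) K = tileImage g (tileImage h K) := by
  apply SetLike.coe_injective
  simp [coe_tileImage, Set.image_image, mul_smul]

namespace TileSet

instance : MulAction AffGroup TileSet where
  smul g T := ⟨tileImage g '' T.tiles⟩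
  one_smul T := by
    apply TileSet.ext
    change tileImage 1 '' T.tiles = T.tiles
    simp [tileImage_one]
  mul_smul g h T := by
    apply TileSet.ext
    change tileImage (g * h) '' T.tiles = tileImage g '' (tileImage h '' T.tiles)
    simp [Set.image_image, tileImage_mul]

theorem smul_tiles (g : AffGroup) (T : TileSet) : (g • T).tiles = tileImage g '' T.tiles := rfl

/-- The patch `T ∩ B_ρ`: the tiles of `T` that meet the open ball of radius `ρ` around `i`. -/
def patch (T : TileSet) (ρ : ℝ) : Set (NonemptyCompacts ℍ) :=
  {K ∈ T.tiles | ((K : Set ℍ) ∩ Metric.ball UpperHalfPlane.I ρ).Nonempty}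

/-- The set of `ε ∈ (0, 1/√2]` such that `g T` and `T'` agree on `B_{1/ε}` for some `g ∈ G` at
distance less than `ε` from the identity; `G` carries the left-invariant metric
`d(g, h) = d(g i, h i)`. -/
def closeness (T T' : TileSet) : Set ℝ :=
  {ε | 0 < ε ∧ ε ≤ 1 / √2 ∧ ∃ g : AffGroup,
    dist (g • UpperHalfPlane.I) UpperHalfPlane.I < ε ∧ (g • T).patch (1 / ε) = T'.patch (1 / ε)}

/-- The distance `δ` of the tiling topology: the infimum of `closeness T T'`, or `1/√2` if that
set is empty. -/
def δ (T T' : TileSet) : ℝ := sInf (insert (1 / √2) (closeness T T'))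

/-- The tiling topology: the topology generated by `δ`. -/
instance : TopologicalSpace TileSet where
  IsOpen U := ∀ T ∈ U, ∃ ε > 0, ∀ T', δ T T' < ε → T' ∈ U
  isOpen_univ _ _ := ⟨1, one_pos, fun _ _ => trivial⟩
  isOpen_inter U V hU hV T hT := by
    obtain ⟨ε, hε, h⟩ := hU T hT.1
    obtain ⟨ε', hε', h'⟩ := hV T hT.2
    exact ⟨min ε ε', lt_min hε hε', fun T' hT' =>
      ⟨h T' (hT'.trans_le (min_le_left _ _)), h' T' (hT'.trans_le (min_le_right _ _))⟩⟩
  isOpen_sUnion 𝒰 h T hT := by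
    obtain ⟨U, hU, hTU⟩ := hT
    obtain ⟨ε, hε, h'⟩ := h U hU T hTU
    exact ⟨ε, hε, fun T' hT' => ⟨U, hU, h' T' hT'⟩⟩

theorem isOpen_def (U : Set TileSet) :
    IsOpen U ↔ ∀ T ∈ U, ∃ ε > 0, ∀ T', δ T T' < ε → T' ∈ U := Iff.rfl

theorem δ_lt_iff {T T' : TileSet} {ε : ℝ} :
    δ T T' < ε ↔ 1 / √2 < ε ∨ ∃ η ∈ closeness T T', η < ε := by
  have hb : BddBelow (insert (1 / √2) (closeness T T')) := by
    refine ⟨0, ?_⟩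
    rintro x (rfl | hx)
    · positivity
    · exact hx.1.le
  rw [δ, csInf_lt_iff hb (Set.insert_nonempty _ _)]
  simp

theorem patch_smul (g : AffGroup) (T : TileSet) (K : NonemptyCompacts ℍ) (ρ : ℝ) :
    K ∈ (g • T).patch ρ ↔ ∃ L ∈ T.tiles, tileImage g L = K ∧
      ((L : Set ℍ) ∩ Metric.ball (g⁻¹ • UpperHalfPlane.I) ρ).Nonempty := by
  have key : ∀ L : NonemptyCompacts ℍ,
      (((tileImage g L : NonemptyCompacts ℍ) : Set ℍ) ∩
        Metric.ball UpperHalfPlane.I ρ).Nonempty ↔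
      ((L : Set ℍ) ∩ Metric.ball (g⁻¹ • UpperHalfPlane.I) ρ).Nonempty := by
    intro L
    have hd : ∀ z : ℍ, dist (g • z) UpperHalfPlane.I = dist z (g⁻¹ • UpperHalfPlane.I) := by
      intro z
      have := g.isometry_smul.dist_eq z (g⁻¹ • UpperHalfPlane.I)
      simpa using this
    rw [coe_tileImage]
    constructor
    · rintro ⟨_, ⟨z, hz, rfl⟩, hzb⟩
      exact ⟨z, hz, by simpa [Metric.mem_ball, hd] using hzb⟩
    · rintro ⟨z, hz, hzb⟩
      exact ⟨g • z, ⟨z, hz, rfl⟩, by simpa [Metric.mem_ball, hd] using hzb⟩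
  constructor
  · rintro ⟨⟨L, hL, rfl⟩, h⟩
    exact ⟨L, hL, rfl, (key L).1 h⟩
  · rintro ⟨L, hL, rfl, h⟩
    exact ⟨⟨L, hL, rfl⟩, (key L).2 h⟩

/-- Elements of `G` that move `i` little move any given point little. -/
theorem exists_dist_smul_lt (z : ℍ) {ε : ℝ} (hε : 0 < ε) : ∃ η > 0, ∀ g : AffGroup,
    dist (g • UpperHalfPlane.I) UpperHalfPlane.I < η → dist (g • z) z < ε := by
  let F : ℍ → ℍ := fun p => p.re +ᵥ ((⟨p.im, p.im_pos⟩ : PosReal) • z)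
  have hF : Continuous F := by
    rw [UpperHalfPlane.isEmbedding_coe.continuous_iff]
    have : (UpperHalfPlane.coe ∘ F) = fun p : ℍ => ((p.re : ℂ) + (p.im : ℝ) • (z : ℂ)) := by
      funext p
      simp [F]
    rw [this]
    have h1 : Continuous fun p : ℍ => p.re := UpperHalfPlane.continuous_re
    have h2 : Continuous fun p : ℍ => p.im := UpperHalfPlane.continuous_im
    fun_prop
  have hI : F UpperHalfPlane.I = z := by
    apply UpperHalfPlane.ext
    simp [F]
  have hg : ∀ g : AffGroup, F (g • UpperHalfPlane.I) = g • z := by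
    intro g
    apply UpperHalfPlane.ext
    simp [F, AffGroup.smul_def]
  obtain ⟨η, hη, h⟩ := Metric.continuous_iff.1 hF UpperHalfPlane.I ε hε
  refine ⟨η, hη, fun g hgη => ?_⟩
  have := h _ hgη
  rwa [hg, hI] at this

theorem continuous_smul (h : AffGroup) : Continuous (fun T : TileSet => h • T) := by
  refine ⟨fun U hU => ?_⟩
  rw [isOpen_def] at hU ⊢
  intro T hT
  obtain ⟨ε, hε, hball⟩ := hU (h • T) hT
  set ε₁ : ℝ := min (ε / 2) (1 / √2) with hε₁
  have hε₁0 : 0 < ε₁ := lt_min (by positivity) (by positivity)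
  set D : ℝ := dist (h⁻¹ • UpperHalfPlane.I) UpperHalfPlane.I
  have hD : 0 ≤ D := dist_nonneg
  obtain ⟨η, hη, hmove⟩ := exists_dist_smul_lt (h⁻¹ • UpperHalfPlane.I) hε₁0
  have hden : 0 < 1 / ε₁ + D := by positivity
  refine ⟨min η (min (1 / √2) (1 / (1 / ε₁ + D))),
    lt_min hη (lt_min (by positivity) (by positivity)), fun T' hT' => ?_⟩
  apply hball
  rw [δ_lt_iff] at hT' ⊢
  right
  obtain hbad | ⟨κ, ⟨hκ0, hκ, g, hgκ, hpatch⟩, hκlt⟩ := hT'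
  · exact absurd hbad (not_lt.2 ((min_le_right _ _).trans (min_le_left _ _)))
  have hκη : κ < η := hκlt.trans_le (min_le_left _ _)
  have hκr : 1 / ε₁ + D ≤ 1 / κ := by
    rw [le_one_div hden hκ0]
    exact (hκlt.trans_le ((min_le_right _ _).trans (min_le_right _ _))).le
  refine ⟨ε₁, ⟨hε₁0, min_le_right _ _, h * g * h⁻¹, ?_, ?_⟩,
    (min_le_left _ _).trans_lt (by linarith)⟩
  · have h1 := hmove g (hgκ.trans hκη)
    have h2 := h.isometry_smul.dist_eq (g • h⁻¹ • UpperHalfPlane.I) (h⁻¹ • UpperHalfPlane.I)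
    simp only [smul_inv_smul] at h2
    rw [mul_smul, mul_smul, h2]
    exact h1
  · have e : (h * g * h⁻¹) • h • T = h • g • T := by
      simp [mul_smul]
    rw [e]
    ext K
    rw [patch_smul, patch_smul]
    have sub : Metric.ball (h⁻¹ • UpperHalfPlane.I) (1 / ε₁) ⊆
        Metric.ball UpperHalfPlane.I (1 / κ) :=
      Metric.ball_subset_ball' hκr
    have hiff : ∀ L : NonemptyCompacts ℍ,
        ((L : Set ℍ) ∩ Metric.ball (h⁻¹ • UpperHalfPlane.I) (1 / ε₁)).Nonempty →
        (L ∈ (g • T).tiles ↔ L ∈ T'.tiles) := by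
      intro L hL
      have hL' := hL.mono (Set.inter_subset_inter_right _ sub)
      have := Set.ext_iff.1 hpatch L
      constructor
      · exact fun hm => (this.1 ⟨hm, hL'⟩).1
      · exact fun hm => (this.2 ⟨hm, hL'⟩).1
    constructor
    · rintro ⟨L, hL, hK, hne⟩
      exact ⟨L, (hiff L hne).1 hL, hK, hne⟩
    · rintro ⟨L, hL, hK, hne⟩
      exact ⟨L, (hiff L hne).2 hL, hK, hne⟩

end TileSet

/-! ### The hyperbolic Penrose tiling and the closure of its `𝒩`-orbit -/

/-- The convex hyperbolic pentagon with vertices `i`, `1/2 + i`, `1 + i`, `1 + 2i`, `2i`, as the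
intersection of the half-planes bounded by the geodesics that carry its edges: the vertical lines
through `0` and `1`, and the half-circles centred on the real axis through `i` and `1/2 + i`,
through `1/2 + i` and `1 + i`, and through `2i` and `1 + 2i`. -/
def pentagon : Set ℍ :=
  {z | 0 ≤ z.re ∧ z.re ≤ 1 ∧
    17 / 16 ≤ (z.re - 1 / 4) ^ 2 + z.im ^ 2 ∧
    17 / 16 ≤ (z.re - 3 / 4) ^ 2 + z.im ^ 2 ∧
    (z.re - 1 / 2) ^ 2 + z.im ^ 2 ≤ 17 / 4}

theorem isCompact_pentagon : IsCompact pentagon := by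
  rw [UpperHalfPlane.isEmbedding_coe.isCompact_iff]
  have himg : UpperHalfPlane.coe '' pentagon =
      {z : ℂ | 0 ≤ z.re ∧ z.re ≤ 1 ∧ 17 / 16 ≤ (z.re - 1 / 4) ^ 2 + z.im ^ 2 ∧
        17 / 16 ≤ (z.re - 3 / 4) ^ 2 + z.im ^ 2 ∧
        (z.re - 1 / 2) ^ 2 + z.im ^ 2 ≤ 17 / 4 ∧ 0 ≤ z.im} := by
    ext z
    constructor
    · rintro ⟨w, ⟨h1, h2, h3, h4, h5⟩, rfl⟩
      exact ⟨h1, h2, h3, h4, h5, w.im_pos.le⟩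
    · rintro ⟨h1, h2, h3, h4, h5, h6⟩
      have hz : 0 < z.im := by
        rcases h6.lt_or_eq with h | h
        · exact h
        · exfalso
          rw [← h] at h3 h4
          rcases le_total z.re (1 / 2) with hx | hx <;> nlinarith
      exact ⟨⟨z, hz⟩, ⟨h1, h2, h3, h4, h5⟩, rfl⟩
  rw [himg]
  apply Metric.isCompact_of_isClosed_isBounded
  · have c1 := Complex.continuous_re
    have c2 := Complex.continuous_im
    have k3 : Continuous fun z : ℂ => (z.re - 1 / 4) ^ 2 + z.im ^ 2 := by fun_prop
    have k4 : Continuous fun z : ℂ => (z.re - 3 / 4) ^ 2 + z.im ^ 2 := by fun_prop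
    have k5 : Continuous fun z : ℂ => (z.re - 1 / 2) ^ 2 + z.im ^ 2 := by fun_prop
    exact (isClosed_le continuous_const c1).and <| (isClosed_le c1 continuous_const).and <|
      (isClosed_le continuous_const k3).and <| (isClosed_le continuous_const k4).and <|
      (isClosed_le k5 continuous_const).and <| isClosed_le continuous_const c2
  · refine (Metric.isBounded_closedBall (x := (0 : ℂ)) (r := 4)).subset ?_
    rintro z ⟨h1, h2, h3, h4, h5, h6⟩
    rw [mem_closedBall_zero_iff]
    refine (Complex.norm_le_abs_re_add_abs_im z).trans ?_
    rw [abs_of_nonneg h1, abs_of_nonneg h6]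
    nlinarith [sq_nonneg (z.re - 1 / 2)]

theorem nonempty_pentagon : pentagon.Nonempty := by
  refine ⟨UpperHalfPlane.I, ?_⟩
  simp only [pentagon, Set.mem_ofPred_eq, UpperHalfPlane.I_re, UpperHalfPlane.I_im]
  norm_num

/-- The prototile `P`. -/
def prototile : NonemptyCompacts ℍ := ⟨⟨pentagon, isCompact_pentagon⟩, nonempty_pentagon⟩

/-- The hyperbolic Penrose tiling `𝒫 = {R^k S^n P | n, k ∈ ℤ}`. -/
def penrose : TileSet :=
  ⟨{K | ∃ k n : ℤ, K = tileImage (AffGroup.R ^ k * AffGroup.S ^ n) prototile}⟩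

theorem R_zpow_smul_penrose (j : ℤ) : (AffGroup.R ^ j) • penrose = penrose := by
  apply TileSet.ext
  rw [TileSet.smul_tiles]
  ext K
  constructor
  · rintro ⟨_, ⟨k, n, rfl⟩, rfl⟩
    exact ⟨j + k, n, by rw [← tileImage_mul, zpow_add, mul_assoc]⟩
  · rintro ⟨k, n, rfl⟩
    exact ⟨_, ⟨-j + k, n, rfl⟩, by rw [← tileImage_mul, zpow_add]; group⟩

/-- The orbit `𝒩.𝒫` of the Penrose tiling under the translations. -/
def orbitN : Set TileSet := Set.range fun s : ℝ => AffGroup.translation s • penrose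

/-- `X^𝒩_𝒫`: the closure of `𝒩.𝒫` for the tiling topology. -/
def HullN : Type := ↥(closure orbitN)

namespace HullN

instance : TopologicalSpace HullN := inferInstanceAs (TopologicalSpace ↥(closure orbitN))

/-- Measures on the hull are Borel measures. -/
instance : MeasurableSpace HullN := borel HullN

instance : BorelSpace HullN := ⟨rfl⟩

theorem translation_mem (s : ℝ) {T : TileSet} (hT : T ∈ closure orbitN) :
    AffGroup.translation s • T ∈ closure orbitN := by
  refine map_mem_closure (TileSet.continuous_smul _) hT ?_
  rintro _ ⟨t, rfl⟩
  exact ⟨s + t, by simp [AffGroup.translation_add, mul_smul]⟩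

theorem R_mem {T : TileSet} (hT : T ∈ closure orbitN) : AffGroup.R • T ∈ closure orbitN := by
  refine map_mem_closure (TileSet.continuous_smul _) hT ?_
  rintro _ ⟨t, rfl⟩
  refine ⟨2 * t, ?_⟩
  change _ = AffGroup.R • AffGroup.translation t • penrose
  rw [smul_smul, AffGroup.R_mul_translation, mul_smul]
  have := R_zpow_smul_penrose 1
  rw [zpow_one] at this
  rw [this]

theorem R_inv_mem {T : TileSet} (hT : T ∈ closure orbitN) :
    AffGroup.R⁻¹ • T ∈ closure orbitN := by
  refine map_mem_closure (TileSet.continuous_smul _) hT ?_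
  rintro _ ⟨t, rfl⟩
  refine ⟨t / 2, ?_⟩
  change _ = AffGroup.R⁻¹ • AffGroup.translation t • penrose
  rw [smul_smul, AffGroup.R_inv_mul_translation, mul_smul]
  have := R_zpow_smul_penrose (-1)
  rw [zpow_neg_one] at this
  rw [this]

/-- `ℝ ≅ 𝒩` acts on `X^𝒩_𝒫` by translations; `s +ᵥ T` is the tiling `T + s`. -/
instance : AddAction ℝ HullN where
  vadd s T := ⟨AffGroup.translation s • T.1, translation_mem s T.2⟩
  zero_vadd T := Subtype.ext (by
    change AffGroup.translation 0 • T.1 = T.1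
    rw [AffGroup.translation_zero, one_smul])
  add_vadd s t T := Subtype.ext (by
    change AffGroup.translation (s + t) • T.1
      = AffGroup.translation s • AffGroup.translation t • T.1
    rw [AffGroup.translation_add, mul_smul])

/-- The bijection `T ↦ R.T` of `X^𝒩_𝒫`. -/
def R : Equiv.Perm HullN where
  toFun T := ⟨AffGroup.R • T.1, R_mem T.2⟩
  invFun T := ⟨AffGroup.R⁻¹ • T.1, R_inv_mem T.2⟩
  left_inv _ := Subtype.ext (inv_smul_smul _ _)
  right_inv _ := Subtype.ext (smul_inv_smul _ _)

theorem R_vadd (s : ℝ) (T : HullN) : R (s +ᵥ T) = (2 * s) +ᵥ R T := Subtype.ext (by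
  change AffGroup.R • AffGroup.translation s • T.1
    = AffGroup.translation (2 * s) • AffGroup.R • T.1
  rw [smul_smul, smul_smul, AffGroup.R_mul_translation])

end HullN

/-! ### The subshift `Z_w` -/

/-- The shift `(w_n) ↦ (w_{n+1})` on sequences in a finite alphabet with `r` letters. -/
def shift (r : ℕ) : (ℤ → Fin r) ≃ₜ (ℤ → Fin r) where
  toFun w n := w (n + 1)
  invFun w n := w (n - 1)
  left_inv w := by funext n; simp
  right_inv w := by funext n; simp
  continuous_toFun := by fun_prop
  continuous_invFun := by fun_prop

/-- `Z_w`: the closure of the shift orbit of `w` in the product topology. -/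
abbrev Subshift {r : ℕ} (w : ℤ → Fin r) : Type :=
  ↥(closure (Set.range fun n : ℤ => ((shift r).toEquiv ^ n : Equiv.Perm (ℤ → Fin r)) w))

/-- The shift `σ` as a bijection of `Z_w`. -/
def subshiftMap {r : ℕ} (w : ℤ → Fin r) : Equiv.Perm (Subshift w) where
  toFun x := ⟨shift r x.1, map_mem_closure (shift r).continuous x.2 (by
    rintro _ ⟨n, rfl⟩
    exact ⟨1 + n, by
      change ((shift r).toEquiv ^ (1 + n) : Equiv.Perm (ℤ → Fin r)) w = _
      rw [zpow_add, zpow_one]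
      rfl⟩)⟩
  invFun x := ⟨(shift r).symm x.1, map_mem_closure (shift r).symm.continuous x.2 (by
    rintro _ ⟨n, rfl⟩
    exact ⟨-1 + n, by
      change ((shift r).toEquiv ^ (-1 + n) : Equiv.Perm (ℤ → Fin r)) w = _
      rw [zpow_add, zpow_neg_one]
      rfl⟩)⟩
  left_inv x := Subtype.ext ((shift r).symm_apply_apply x.1)
  right_inv x := Subtype.ext ((shift r).apply_symm_apply x.1)

/-! ### The double suspension -/

/-- `X^𝒩_𝒫 × Z_w × ℝ*₊`. -/
abbrev TotalSpace {r : ℕ} (w : ℤ → Fin r) : Type := HullN × Subshift w × PosReal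

/-- `ℛ(T, w', t) = (R.T, σ(w'), t / 2)`. -/
def suspMap {r : ℕ} (w : ℤ → Fin r) : Equiv.Perm (TotalSpace w) :=
  HullN.R.prodCongr ((subshiftMap w).prodCongr (Equiv.divRight (⟨2, two_pos⟩ : PosReal)))

/-- The double suspension `(X^𝒩_𝒫 × Z_w × ℝ*₊) / ℛ`: the quotient by the orbits of `ℛ`. -/
def DoubleSuspension {r : ℕ} (w : ℤ → Fin r) : Type :=
  Quotient (Equiv.Perm.SameCycle.setoid (suspMap w))

/-- An element `g : z ↦ a z + b` of `G` acts on `X^𝒩_𝒫 × Z_w × ℝ*₊` by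
`(T, w', t) ↦ (T + b / (a t), w', a t)`. -/
def totalAct {r : ℕ} (w : ℤ → Fin r) (g : AffGroup) (x : TotalSpace w) : TotalSpace w :=
  ((g.b / (g.a * x.2.2)) +ᵥ x.1, x.2.1, g.a * x.2.2)

theorem totalAct_one {r : ℕ} (w : ℤ → Fin r) (x : TotalSpace w) : totalAct w 1 x = x := by
  simp [totalAct, AffGroup.one_a, AffGroup.one_b]

theorem totalAct_mul {r : ℕ} (w : ℤ → Fin r) (g h : AffGroup) (x : TotalSpace w) :
    totalAct w (g * h) x = totalAct w g (totalAct w h x) := by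
  obtain ⟨T, v, t⟩ := x
  have h1 : (g.a : ℝ) ≠ 0 := g.a.2.ne'
  have h2 : (h.a : ℝ) ≠ 0 := h.a.2.ne'
  have h3 : (t : ℝ) ≠ 0 := t.2.ne'
  refine Prod.ext ?_ (Prod.ext rfl (mul_assoc g.a h.a t))
  simp only [totalAct, AffGroup.mul_a, AffGroup.mul_b, vadd_vadd, Positive.val_mul]
  congr 1
  field_simp
  ring

theorem suspMap_totalAct {r : ℕ} (w : ℤ → Fin r) (g : AffGroup) (x : TotalSpace w) :
    suspMap w (totalAct w g x) = totalAct w g (suspMap w x) := by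
  obtain ⟨T, v, t⟩ := x
  have h1 : (g.a : ℝ) ≠ 0 := g.a.2.ne'
  have h3 : (t : ℝ) ≠ 0 := t.2.ne'
  refine Prod.ext ?_ (Prod.ext rfl (mul_div_assoc g.a t _))
  change HullN.R ((g.b / (g.a * t)) +ᵥ T)
    = (g.b / (g.a * ((t / ⟨2, two_pos⟩ : PosReal) : ℝ))) +ᵥ HullN.R T
  rw [HullN.R_vadd]
  congr 1
  have : ((t / ⟨2, two_pos⟩ : PosReal) : ℝ) = t / 2 := by
    simp [div_eq_mul_inv]
  rw [this]
  field_simp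

theorem suspMap_zpow_totalAct {r : ℕ} (w : ℤ → Fin r) (g : AffGroup) (n : ℤ)
    (x : TotalSpace w) :
    (suspMap w ^ n) (totalAct w g x) = totalAct w g ((suspMap w ^ n) x) := by
  have hs : ∀ y, (suspMap w)⁻¹ (totalAct w g y) = totalAct w g ((suspMap w)⁻¹ y) := by
    intro y
    rw [Equiv.Perm.inv_eq_iff_eq, suspMap_totalAct]
    exact congrArg (totalAct w g) ((suspMap w).apply_symm_apply y).symm
  induction n with
  | zero => simp
  | succ n ih =>
    rw [add_comm, zpow_add, zpow_one, Equiv.Perm.mul_apply, ih, suspMap_totalAct,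
      Equiv.Perm.mul_apply]
  | pred n ih =>
    rw [sub_eq_neg_add, zpow_add, zpow_neg_one, Equiv.Perm.mul_apply, ih, hs,
      Equiv.Perm.mul_apply]

namespace DoubleSuspension

variable {r : ℕ} (w : ℤ → Fin r)

instance : TopologicalSpace (DoubleSuspension w) :=
  inferInstanceAs (TopologicalSpace (Quotient (Equiv.Perm.SameCycle.setoid (suspMap w))))

/-- Measures on the double suspension are Borel measures. -/
instance : MeasurableSpace (DoubleSuspension w) := borel (DoubleSuspension w)

instance : BorelSpace (DoubleSuspension w) := ⟨rfl⟩

/-- The canonical projection `π`. -/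
def proj (x : TotalSpace w) : DoubleSuspension w := Quotient.mk _ x

/-- The action of `G` induced on the double suspension. -/
instance : MulAction AffGroup (DoubleSuspension w) where
  smul g := Quotient.map (totalAct w g) (by
    rintro x _ ⟨n, rfl⟩
    exact ⟨n, suspMap_zpow_totalAct w g n x⟩)
  one_smul p := by
    induction p using Quotient.inductionOn with
    | h x => exact congrArg (proj w) (totalAct_one w x)
  mul_smul g h p := by
    induction p using Quotient.inductionOn with
    | h x => exact congrArg (proj w) (totalAct_mul w g h x)

theorem smul_proj (g : AffGroup) (x : TotalSpace w) :
    g • proj w x = proj w (totalAct w g x) := rfl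

/-- The measure `θ` is locally the image of `η` through the projection: every point of the total
space has an open neighbourhood `U` that the projection maps homeomorphically onto an open set, and
the restriction of `θ` to the image of `U` is the image of the restriction of `η` to `U`. -/
def IsLocallyImage (θ : Measure (DoubleSuspension w)) (η : Measure (TotalSpace w)) : Prop :=
  ∀ x : TotalSpace w, ∃ U : Set (TotalSpace w), IsOpen U ∧ x ∈ U ∧
    IsOpenEmbedding (U.domRestrict (proj w)) ∧
    θ.restrict (proj w '' U) = (η.restrict U).map (proj w)

end DoubleSuspension

/-- `ν` is the only probability measure on `X^𝒩_𝒫` that is invariant under the translations. -/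
def IsUniqueInvariantProbability (ν : Measure HullN) : Prop :=
  IsProbabilityMeasure ν ∧ VAddInvariantMeasure ℝ HullN ν ∧
    ∀ ν' : Measure HullN, IsProbabilityMeasure ν' → VAddInvariantMeasure ℝ HullN ν' → ν' = ν

end

end HypPenrose

namespace HypPenrose

namespace AffGroup

/-! The hull is a dyadic solenoid. In a limit of translates of the Penrose tiling, the row of tiles
at scale `2 ^ k` is the Penrose row moved horizontally, so it is recorded by an offset `y k` in the
circle, and the rows fit together exactly when `y k = 2 y (k + 1)`. The map `tilingOf` carries the
solenoid continuously and injectively onto the hull (`closure_orbitN`) and turns translations into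
the flow along the dense one-parameter subgroup `line`. Since the solenoid is compact and the hull
Hausdorff, this is a homeomorphism. A finite measure invariant under a dense subgroup of a compact
group is invariant under the whole group, hence a multiple of Haar measure (`eq_smul_hullMeasure`);
this gives `ν`.

A finite invariant `θ` on the double suspension is unfolded to a measure `lift w θ` on the total
space, which gives `A` the mass `θ (π A)` whenever `π` is injective on `A`. It therefore inherits
invariance under `G` and under `ℛ`. Dilations move only the height `t`, so the lift splits as `κ ⊗
m` (`exists_eq_prod_haar`). Translation by `b` moves the hull by `b / t` at height `t`; continuity
in `t` then makes `κ` invariant under the flow (`map_eq_of_prod_invariant`). Uniqueness of `ν`,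
applied to the slices of `κ` over subsets of `Z_w`, gives `κ = ν ⊗ μ`. Finally, invariance under `ℛ`
makes `μ` shift-invariant, because `ν` has mass one and `m` does not see the factor `1 / 2`. -/

theorem smul_I_re (g : AffGroup) : (g • UpperHalfPlane.I).re = g.b := by
  simp [smul_def]

theorem smul_I_im (g : AffGroup) : (g • UpperHalfPlane.I).im = g.a := by
  simp [smul_def]

theorem smul_im (g : AffGroup) (z : ℍ) : (g • z).im = g.a * z.im := by
  simp [smul_def]

theorem dist_smul_smul (g : AffGroup) (z w : ℍ) : dist (g • z) (g • w) = dist z w :=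
  g.isometry_smul.dist_eq z w

theorem eq_one_of_smul_I {g : AffGroup} (h : g • UpperHalfPlane.I = UpperHalfPlane.I) :
    g = 1 := by
  refine AffGroup.ext (Subtype.ext ?_) ?_
  · rw [← smul_I_im, h]; rfl
  · rw [← smul_I_re, h]; rfl

theorem dist_inv_smul_I (g : AffGroup) :
    dist (g⁻¹ • UpperHalfPlane.I) UpperHalfPlane.I
      = dist (g • UpperHalfPlane.I) UpperHalfPlane.I := by
  rw [← dist_smul_smul g, smul_inv_smul, dist_comm]

end AffGroup

/-! ### Neighbourhoods in the tiling topology -/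

namespace TileSet

theorem mem_smul_tiles {g : AffGroup} {T : TileSet} {K : NonemptyCompacts ℍ} :
    K ∈ (g • T).tiles ↔ tileImage g⁻¹ K ∈ T.tiles := by
  rw [smul_tiles]
  constructor
  · rintro ⟨L, hL, rfl⟩
    rwa [← tileImage_mul, inv_mul_cancel, tileImage_one]
  · intro h
    exact ⟨_, h, by rw [← tileImage_mul, mul_inv_cancel, tileImage_one]⟩

/-- The tile `K` meets the open ball of radius `ρ` around `i`. -/
def Meets (K : NonemptyCompacts ℍ) (ρ : ℝ) : Prop :=
  ((K : Set ℍ) ∩ Metric.ball UpperHalfPlane.I ρ).Nonempty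

theorem Meets.mono {K : NonemptyCompacts ℍ} {ρ ρ' : ℝ} (h : Meets K ρ) (hρ : ρ ≤ ρ') :
    Meets K ρ' :=
  Set.Nonempty.mono (Set.inter_subset_inter_right _ (Metric.ball_subset_ball hρ)) h

theorem Meets.tileImage {K : NonemptyCompacts ℍ} {ρ : ℝ} (h : Meets K ρ) (g : AffGroup) :
    Meets (tileImage g K) (ρ + dist (g • UpperHalfPlane.I) UpperHalfPlane.I) := by
  obtain ⟨z, hz, hzρ⟩ := h
  refine ⟨g • z, ⟨z, hz, rfl⟩, ?_⟩
  rw [Metric.mem_ball] at hzρ ⊢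
  refine (dist_triangle _ (g • UpperHalfPlane.I) _).trans_lt ?_
  rw [AffGroup.dist_smul_smul]
  linarith

theorem exists_meets (K : NonemptyCompacts ℍ) : ∃ ρ > 0, Meets K ρ := by
  obtain ⟨z, hz⟩ := K.nonempty
  exact ⟨dist z UpperHalfPlane.I + 1, by positivity, z, hz, by simp⟩

/-- Up to an element of `G` at distance less than `ε` from the identity, `T` and `T'` have the
same tiles in the ball of radius `1 / ε`. -/
def Near (ε : ℝ) (T T' : TileSet) : Prop :=
  ∃ g : AffGroup, dist (g • UpperHalfPlane.I) UpperHalfPlane.I < ε ∧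
    ∀ K, Meets K (1 / ε) → (K ∈ (g • T).tiles ↔ K ∈ T'.tiles)

theorem patch_eq_patch_iff {T T' : TileSet} {ρ : ℝ} :
    T.patch ρ = T'.patch ρ ↔ ∀ K, Meets K ρ → (K ∈ T.tiles ↔ K ∈ T'.tiles) := by
  simp only [Set.ext_iff, patch, Set.mem_ofPred_eq, Meets, and_congr_left_iff]

theorem Near.mono {ε ε' : ℝ} (hε : 0 < ε) (h : ε ≤ ε') {T T' : TileSet} (hT : Near ε T T') :
    Near ε' T T' := by
  obtain ⟨g, hg, hK⟩ := hT
  exact ⟨g, hg.trans_le h, fun K hm => hK K (hm.mono (one_div_le_one_div_of_le hε h))⟩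

theorem Near.refl {ε : ℝ} (hε : 0 < ε) (T : TileSet) : Near ε T T :=
  ⟨1, by simpa using hε, fun K _ => by rw [one_smul]⟩

/-- Halving `ε` doubles the radius `1 / ε`; for `ε ≤ 1` the gain exceeds the displacement `ε / 2`.
This is why `Near` is symmetric and transitive up to a factor 2. -/
theorem half_radius {ε : ℝ} (hε : 0 < ε) (hε1 : ε ≤ 1) : 1 / ε + ε / 2 ≤ 1 / (ε / 2) := by
  have h1 : 1 ≤ 1 / ε := by rwa [le_div_iff₀ hε, one_mul]
  have h2 : 1 / (ε / 2) = 2 * (1 / ε) := by field_simp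
  linarith

theorem Near.symm {ε : ℝ} (hε : 0 < ε) (hε1 : ε ≤ 1) {T T' : TileSet}
    (h : Near (ε / 2) T T') : Near ε T' T := by
  obtain ⟨g, hg, hK⟩ := h
  refine ⟨g⁻¹, by rw [AffGroup.dist_inv_smul_I]; linarith, fun K hm => ?_⟩
  rw [mem_smul_tiles, inv_inv, ← hK, mem_smul_tiles, ← tileImage_mul, inv_mul_cancel,
    tileImage_one]
  refine (hm.tileImage g).mono ?_
  linarith [half_radius hε hε1]

theorem Near.trans {ε : ℝ} (hε : 0 < ε) (hε1 : ε ≤ 1) {T T' T'' : TileSet}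
    (h : Near (ε / 2) T T') (h' : Near (ε / 2) T' T'') : Near ε T T'' := by
  obtain ⟨g, hg, hK⟩ := h
  obtain ⟨g', hg', hK'⟩ := h'
  refine ⟨g' * g, ?_, fun K hm => ?_⟩
  · rw [mul_smul]
    refine (dist_triangle _ (g' • UpperHalfPlane.I) _).trans_lt ?_
    rw [AffGroup.dist_smul_smul]
    linarith
  · have hr := half_radius hε hε1
    rw [← hK' K (hm.mono (by linarith)), mul_smul, mem_smul_tiles, mem_smul_tiles (T := T')]
    apply hK
    refine (hm.tileImage g'⁻¹).mono ?_
    rw [AffGroup.dist_inv_smul_I]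
    linarith

theorem near_of_δ_lt {ε : ℝ} (h1 : ε ≤ 1 / √2) {T T' : TileSet} (h : δ T T' < ε) :
    Near ε T T' := by
  rw [δ_lt_iff] at h
  obtain h | ⟨η, ⟨hη, -, g, hg, hp⟩, hlt⟩ := h
  · exact absurd h (not_lt.2 h1)
  · exact Near.mono hη hlt.le ⟨g, hg, patch_eq_patch_iff.1 hp⟩

theorem δ_lt_of_near {ε ε' : ℝ} (hε : 0 < ε) (h1 : ε ≤ 1 / √2) (hlt : ε < ε') {T T' : TileSet}
    (h : Near ε T T') : δ T T' < ε' := by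
  rw [δ_lt_iff]
  obtain ⟨g, hg, hK⟩ := h
  exact Or.inr ⟨ε, ⟨hε, h1, g, hg, patch_eq_patch_iff.2 hK⟩, hlt⟩

/-- Only small `ε` matter for openness, so the cap `1 / √2` in `δ` plays no role and `Near` alone
describes the topology. -/
theorem isOpen_iff_near {U : Set TileSet} :
    IsOpen U ↔ ∀ T ∈ U, ∃ ε > 0, ∀ T', Near ε T T' → T' ∈ U := by
  rw [isOpen_def]
  constructor
  · intro h T hT
    obtain ⟨ε, hε, hU⟩ := h T hT
    have hpos : 0 < min (ε / 2) (1 / √2) := lt_min (by positivity) (by positivity)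
    refine ⟨_, hpos, fun T' hT' => hU T' (δ_lt_of_near hpos (min_le_right _ _) ?_ hT')⟩
    exact (min_le_left _ _).trans_lt (by linarith)
  · intro h T hT
    obtain ⟨ε, hε, hU⟩ := h T hT
    have hpos : 0 < min ε (1 / √2) := lt_min (by positivity) (by positivity)
    exact ⟨_, hpos, fun T' hT' =>
      hU T' ((near_of_δ_lt (min_le_right _ _) hT').mono hpos (min_le_left _ _))⟩

/-- The `Near` ball itself need not be open. Its points that have a smaller ball inside it form an
open set, since `Near.trans` allows radii to be halved. -/
theorem near_mem_nhds {ε : ℝ} (hε : 0 < ε) (T : TileSet) : {T' | Near ε T T'} ∈ 𝓝 T := by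
  rw [mem_nhds_iff]
  refine ⟨{T' | ∃ η > 0, ∀ T'', Near η T' T'' → Near ε T T''}, ?_, ?_, ε, hε, fun _ h => h⟩
  · rintro T' ⟨η, hη, h⟩
    exact h T' (Near.refl hη T')
  · rw [isOpen_iff_near]
    rintro T' ⟨η, hη, h⟩
    have hpos : 0 < min η 1 := lt_min hη one_pos
    refine ⟨min η 1 / 2, half_pos hpos, fun T₁ h₁ => ⟨min η 1 / 2, half_pos hpos, ?_⟩⟩
    exact fun T₂ h₂ => h T₂ ((Near.trans hpos (min_le_right _ _) h₁ h₂).mono hpos (min_le_left _ _))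

theorem nhds_basis_near (T : TileSet) :
    (𝓝 T).HasBasis (fun ε : ℝ => 0 < ε) (fun ε => {T' | Near ε T T'}) := by
  refine ⟨fun s => ⟨fun hs => ?_, fun ⟨ε, hε, h⟩ => Filter.mem_of_superset (near_mem_nhds hε T) h⟩⟩
  obtain ⟨U, hUs, hU, hT⟩ := mem_nhds_iff.1 hs
  obtain ⟨ε, hε, h⟩ := isOpen_iff_near.1 hU T hT
  exact ⟨ε, hε, fun T' hT' => hUs (h T' hT')⟩

theorem near_of_inseparable {T T' : TileSet} (h : Inseparable T T') {ε : ℝ} (hε : 0 < ε) :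
    Near ε T T' := by
  have hmem := near_mem_nhds hε T
  rw [h.nhds_eq] at hmem
  exact (mem_of_mem_nhds hmem : T' ∈ {T'' | Near ε T T''})

/-- Near-symmetry and near-transitivity give separation up to inseparability and no more: the
translates of a tile by the rationals and by a coset `√2 + ℚ` are `Near` at every scale without
being equal. -/
instance : R1Space TileSet where
  specializes_or_disjoint_nhds T T' := by
    rw [or_iff_not_imp_right]
    intro hd
    rw [(nhds_basis_near T).disjoint_iff (nhds_basis_near T')] at hd
    push Not at hd
    have key : ∀ ε : ℝ, 0 < ε → ε ≤ 1 → Near ε T' T := by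
      intro ε hε hε1
      obtain ⟨T'', h1, h2⟩ := Set.not_disjoint_iff.1
        (hd (ε / 2 / 2) (by positivity) (ε / 2 / 2) (by positivity))
      refine Near.trans hε hε1 (h2.mono (by positivity) (by linarith)) ?_
      exact Near.symm (by positivity) (by linarith) h1
    rw [specializes_iff_pure, (nhds_basis_near T').ge_iff]
    intro ε hε
    rw [Filter.mem_pure]
    exact (key (min ε 1) (lt_min hε one_pos) (min_le_right _ _)).mono (lt_min hε one_pos)
      (min_le_left _ _)

end TileSet

/-! ### The dyadic solenoid -/

/-- The dyadic solenoid, as the group of sequences `y` of points of the circle with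
`y k = 2 y (k + 1)`. -/
def solenoid : AddSubgroup (ℤ → UnitAddCircle) where
  carrier := {y | ∀ k, y k = (2 : ℕ) • y (k + 1)}
  zero_mem' k := by simp
  add_mem' {x y} hx hy k := by
    rw [Pi.add_apply, hx k, hy k, Pi.add_apply, smul_add]
  neg_mem' {x} hx k := by
    rw [Pi.neg_apply, hx k, Pi.neg_apply, smul_neg]

namespace solenoid

theorem apply_eq (y : solenoid) (k : ℤ) : y.1 k = (2 : ℕ) • y.1 (k + 1) := y.2 k

theorem apply_eq_add (y : solenoid) (k : ℤ) (n : ℕ) : y.1 k = (2 ^ n : ℕ) • y.1 (k + n) := by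
  induction n with
  | zero => simp
  | succ n ih =>
    rw [ih, apply_eq y (k + n), smul_smul, pow_succ]
    push_cast
    rw [add_assoc]

theorem isClosed_coe : IsClosed (solenoid : Set (ℤ → UnitAddCircle)) := by
  have : (solenoid : Set (ℤ → UnitAddCircle)) = ⋂ k : ℤ, {y | y k = (2 : ℕ) • y (k + 1)} := by
    ext y
    simp only [Set.mem_iInter]
    rfl
  rw [this]
  exact isClosed_iInter fun k => isClosed_eq (continuous_apply k) (by fun_prop)

instance : SecondCountableTopology solenoid :=
  TopologicalSpace.Subtype.secondCountableTopology _

instance : CompactSpace solenoid := isCompact_iff_compactSpace.1 isClosed_coe.isCompact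

/-- The dense one-parameter subgroup of the solenoid. -/
noncomputable def line : ℝ →+ solenoid where
  toFun s := ⟨fun k => ((s / 2 ^ k : ℝ) : UnitAddCircle), fun k => by
    rw [← AddCircle.coe_nsmul, nsmul_eq_mul, zpow_add_one₀ two_ne_zero]
    push_cast
    field_simp⟩
  map_zero' := Subtype.ext (funext fun k => by simp)
  map_add' s t := Subtype.ext (funext fun k => by
    change (((s + t) / 2 ^ k : ℝ) : UnitAddCircle) = (s / 2 ^ k : ℝ) + (t / 2 ^ k : ℝ)
    rw [add_div, AddCircle.coe_add])

theorem line_apply (s : ℝ) (k : ℤ) : (line s).1 k = ((s / 2 ^ k : ℝ) : UnitAddCircle) := rfl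

theorem apply_eq_of_le {x y : solenoid} {j k : ℤ} (hjk : j ≤ k) (h : x.1 k = y.1 k) :
    x.1 j = y.1 j := by
  obtain ⟨n, rfl⟩ := Int.le.dest hjk
  rw [apply_eq_add x j n, apply_eq_add y j n, h]

theorem continuous_line : Continuous line :=
  Continuous.subtype_mk (continuous_pi fun _ =>
    (AddCircle.continuous_mk' (1 : ℝ)).comp (continuous_id.div_const _)) _

/-- A real parameter can match any single coordinate, and a coordinate determines all lower ones.
Matching coordinate `n` for each `n` therefore gives pointwise eventually constant convergence. -/
theorem denseRange_line : DenseRange line := by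
  intro y
  have hex : ∀ n : ℕ, ∃ s : ℝ, (line s).1 n = y.1 n := by
    intro n
    obtain ⟨u, hu⟩ := QuotientAddGroup.mk_surjective (y.1 n)
    refine ⟨u * 2 ^ (n : ℤ), ?_⟩
    rw [line_apply, mul_div_cancel_right₀ _ (by positivity)]
    exact hu
  choose s hs using hex
  refine mem_closure_of_tendsto (f := fun n => line (s n)) (b := Filter.atTop) ?_
    (Filter.Eventually.of_forall fun n => ⟨s n, rfl⟩)
  rw [tendsto_subtype_rng, tendsto_pi_nhds]
  intro k
  refine tendsto_const_nhds.congr' ?_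
  filter_upwards [Filter.eventually_ge_atTop k.toNat] with n hn
  exact apply_eq_of_le (by omega) (hs n).symm

end solenoid

/-! ### Tilings encoded by the solenoid -/

namespace AffGroup

/-- `z ↦ a z`, as a homomorphism. -/
def dilation : PosReal →* AffGroup where
  toFun a := ⟨a, 0⟩
  map_one' := rfl
  map_mul' a b := AffGroup.ext rfl (by simp [mul_b])

theorem R_zpow_mul_translation (k : ℤ) (u : ℝ) :
    ((R ^ k * translation u).a : ℝ) = 2 ^ k ∧ (R ^ k * translation u).b = 2 ^ k * u := by
  have h : R ^ k = dilation (⟨2, two_pos⟩ ^ k) := by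
    rw [map_zpow]; rfl
  rw [h, mul_a, mul_b]
  simp [dilation, translation]

theorem S_zpow (n : ℤ) : S ^ n = translation n := by
  let f : Multiplicative ℝ →* AffGroup :=
    { toFun := fun s => translation s.toAdd
      map_one' := rfl
      map_mul' := fun s t => translation_add _ _ }
  have h : S = f (Multiplicative.ofAdd 1) := rfl
  rw [h, ← map_zpow]
  exact congrArg translation (by rw [← ofAdd_zsmul]; simp)

end AffGroup

/-- The elements of `G` that carry the prototile to the tiles of the tiling encoded by `y`. -/
def frames (y : solenoid) : Set AffGroup :=
  {g | ∃ k : ℤ, (g.a : ℝ) = 2 ^ k ∧ ((g.b / 2 ^ k : ℝ) : UnitAddCircle) = y.1 k}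

/-- The tiling encoded by a point `y` of the solenoid: the row of tiles at level `k` is that of the
Penrose tiling, translated by `2 ^ k (y k)`. -/
def tilingOf (y : solenoid) : TileSet :=
  ⟨{K | ∃ g ∈ frames y, K = tileImage g prototile}⟩

theorem I_mem_pentagon : UpperHalfPlane.I ∈ pentagon := by
  simp only [pentagon, Set.mem_ofPred_eq, UpperHalfPlane.I_re, UpperHalfPlane.I_im]
  norm_num

theorem re_nonneg_of_mem_pentagon {z : ℍ} (hz : z ∈ pentagon) : 0 ≤ z.re := hz.1

theorem one_le_im_of_mem_pentagon {z : ℍ} (hz : z ∈ pentagon) : 1 ≤ z.im := by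
  obtain ⟨h1, h2, h3, h4, -⟩ := hz
  have hpos := z.im_pos
  by_contra! hlt
  -- On each half of the strip one of the two lower arcs applies with horizontal offset at most `1 /
  -- 4`, so `im ^ 2 ≥ 17 / 16 - 1 / 16 = 1`.
  rcases le_total z.re (1 / 2) with hx | hx <;> nlinarith

/-- The prototile has no symmetry in `G`: the vertex `i` is at once a lowest and a leftmost point,
so a symmetry has `a ≥ 1` and `b ≥ 0`, and the same bounds for its inverse force the identity. -/
theorem tileImage_prototile_injective :
    Function.Injective fun g : AffGroup => tileImage g prototile := by
  have key : ∀ q : AffGroup, tileImage q prototile = prototile → 1 ≤ (q.a : ℝ) ∧ 0 ≤ q.b := by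
    intro q hq
    have hmem : q • UpperHalfPlane.I ∈ pentagon := by
      have h : q • UpperHalfPlane.I ∈ (tileImage q prototile : Set ℍ) :=
        ⟨_, I_mem_pentagon, rfl⟩
      rwa [hq] at h
    rw [← AffGroup.smul_I_im, ← AffGroup.smul_I_re]
    exact ⟨one_le_im_of_mem_pentagon hmem, re_nonneg_of_mem_pentagon hmem⟩
  intro g h hgh
  dsimp only at hgh
  have h1 : tileImage (h⁻¹ * g) prototile = prototile := by
    rw [tileImage_mul, hgh, ← tileImage_mul,
      inv_mul_cancel, tileImage_one]
  have h2 : tileImage (h⁻¹ * g)⁻¹ prototile = prototile := by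
    conv_lhs => rw [← h1]
    rw [← tileImage_mul, inv_mul_cancel, tileImage_one]
  suffices hq : h⁻¹ * g = 1 by rw [← inv_mul_eq_one.1 hq]
  generalize h⁻¹ * g = q at h1 h2 ⊢
  obtain ⟨ha, hb⟩ := key q h1
  obtain ⟨ha', hb'⟩ := key _ h2
  have hinv : (q⁻¹).b = -((q.a⁻¹ : PosReal) : ℝ) * q.b := rfl
  rw [AffGroup.inv_a] at ha'
  rw [hinv] at hb'
  have hpos : 0 < ((q.a⁻¹ : PosReal) : ℝ) := (q.a⁻¹).2
  have hmul : ((q.a⁻¹ : PosReal) : ℝ) * q.a = 1 := by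
    rw [← Positive.val_mul, inv_mul_cancel]; rfl
  refine AffGroup.ext (Subtype.ext ?_) ?_
  · change (q.a : ℝ) = 1
    nlinarith
  · change q.b = 0
    nlinarith

theorem tileImage_mem_tilingOf {y : solenoid} {g : AffGroup} :
    tileImage g prototile ∈ (tilingOf y).tiles ↔ g ∈ frames y := by
  constructor
  · rintro ⟨h, hh, heq⟩
    rwa [tileImage_prototile_injective heq]
  · exact fun h => ⟨g, h, rfl⟩

theorem translation_mul_mem_frames {s : ℝ} {y : solenoid} {g : AffGroup} :
    AffGroup.translation s * g ∈ frames (solenoid.line s + y) ↔ g ∈ frames y := by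
  refine exists_congr fun k => ?_
  have ha : ((AffGroup.translation s * g).a : ℝ) = g.a := by
    rw [AffGroup.mul_a]; simp [AffGroup.translation]
  have hb : (AffGroup.translation s * g).b = s + g.b := by
    rw [AffGroup.mul_b]; simp [AffGroup.translation, add_comm]
  have hy : (solenoid.line s + y).1 k = (solenoid.line s).1 k + y.1 k := rfl
  rw [ha, hb, hy, solenoid.line_apply, add_div, AddCircle.coe_add, add_right_inj]

theorem translation_smul_tilingOf (s : ℝ) (y : solenoid) :
    AffGroup.translation s • tilingOf y = tilingOf (solenoid.line s + y) := by
  have hinv : AffGroup.translation (-s) = (AffGroup.translation s)⁻¹ := by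
    rw [eq_inv_iff_mul_eq_one, ← AffGroup.translation_add, neg_add_cancel,
      AffGroup.translation_zero]
  apply TileSet.ext
  ext K
  rw [TileSet.mem_smul_tiles]
  constructor
  · rintro ⟨g, hg, hK⟩
    refine ⟨AffGroup.translation s * g, translation_mul_mem_frames.2 hg, ?_⟩
    rw [tileImage_mul, ← hK, ← tileImage_mul, mul_inv_cancel, tileImage_one]
  · rintro ⟨g, hg, rfl⟩
    rw [← tileImage_mul, tileImage_mem_tilingOf, ← translation_mul_mem_frames (s := s)]
    simpa [← mul_assoc] using hg

theorem penrose_eq : penrose = tilingOf 0 := by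
  apply TileSet.ext
  ext K
  constructor
  · rintro ⟨k, n, rfl⟩
    rw [tileImage_mem_tilingOf, AffGroup.S_zpow]
    obtain ⟨h1, h2⟩ := AffGroup.R_zpow_mul_translation k n
    refine ⟨k, h1, ?_⟩
    rw [h2, mul_div_cancel_left₀ _ (by positivity)]
    change _ = (0 : UnitAddCircle)
    rw [AddCircle.coe_eq_zero_iff]
    exact ⟨n, by simp⟩
  · rintro ⟨g, ⟨k, hk, hb⟩, rfl⟩
    obtain ⟨n, hn⟩ := (AddCircle.coe_eq_zero_iff _).1 hb
    refine ⟨k, n, ?_⟩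
    obtain ⟨h1, h2⟩ := AffGroup.R_zpow_mul_translation k n
    congr 1
    refine AffGroup.ext (Subtype.ext ?_) ?_
    · rw [AffGroup.S_zpow, h1, hk]
    · rw [AffGroup.S_zpow, h2]
      rw [zsmul_eq_mul, mul_one, eq_div_iff (by positivity)] at hn
      linarith

/-- A tile has a well-defined scale and position, so the tiles of scale `2 ^ k` alone recover `y k`.
-/
theorem tilingOf_injective : Function.Injective tilingOf := by
  intro x y hxy
  refine Subtype.ext (funext fun k => ?_)
  obtain ⟨u, hu⟩ := QuotientAddGroup.mk_surjective (x.1 k)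
  obtain ⟨h1, h2⟩ := AffGroup.R_zpow_mul_translation k u
  have hx : AffGroup.R ^ k * AffGroup.translation u ∈ frames x := by
    refine ⟨k, h1, ?_⟩
    rw [h2, mul_div_cancel_left₀ _ (by positivity)]
    exact hu
  rw [← tileImage_mem_tilingOf, hxy, tileImage_mem_tilingOf] at hx
  obtain ⟨j, hj, hb⟩ := hx
  rw [h1] at hj
  obtain rfl := zpow_right_injective₀ two_pos (by norm_num) hj
  rw [h2, mul_div_cancel_left₀ _ (by positivity)] at hb
  exact hu.symm.trans hb

/-! ### Rigidity of the encoded tilings -/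

/-- Distinct elements of a coset of `frames y` are uniformly separated. -/
theorem frames_separated (y : solenoid) (q : AffGroup) : ∃ ε > 0, ∀ g h : AffGroup,
    dist (g • UpperHalfPlane.I) UpperHalfPlane.I < ε →
    dist (h • UpperHalfPlane.I) UpperHalfPlane.I < ε →
    g * q ∈ frames y → h * q ∈ frames y → g = h := by
  have hq : (0 : ℝ) < q.a := q.a.2
  -- Heights in `(3/4, 5/4)` have ratio below 2, which forces equal scales. Horizontal parts then
  -- differ by less than `q.a / 2`, below the spacing `g.a * q.a > 3/4 * q.a` of the row.
  have hU : {z : ℍ | |z.re| < q.a / 4 ∧ 3 / 4 < z.im ∧ z.im < 5 / 4} ∈ 𝓝 UpperHalfPlane.I := by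
    apply IsOpen.mem_nhds
    · have c1 := UpperHalfPlane.continuous_re
      have c2 := UpperHalfPlane.continuous_im
      exact (isOpen_lt c1.abs continuous_const).and
        ((isOpen_lt continuous_const c2).and (isOpen_lt c2 continuous_const))
    · refine ⟨?_, ?_, ?_⟩
      · simpa using hq
      · norm_num
      · norm_num
  obtain ⟨ε, hε, hball⟩ := Metric.mem_nhds_iff.1 hU
  refine ⟨ε, hε, fun g h hg hh ⟨k, hk, hkb⟩ ⟨j, hj, hjb⟩ => ?_⟩
  obtain ⟨g1, g2, g3⟩ := hball (Metric.mem_ball.2 hg)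
  obtain ⟨h1, h2, h3⟩ := hball (Metric.mem_ball.2 hh)
  rw [AffGroup.smul_I_re] at g1 h1
  rw [AffGroup.smul_I_im] at g2 g3 h2 h3
  rw [AffGroup.mul_a, Positive.val_mul] at hk hj
  have two_le : ∀ {i l : ℤ}, i < l → 2 * (2 : ℝ) ^ i ≤ 2 ^ l := by
    intro i l hil
    rw [mul_comm, ← zpow_add_one₀ two_ne_zero]
    exact zpow_le_zpow_right₀ one_le_two hil
  have hkj : k = j := by
    rcases lt_trichotomy k j with hlt | heq | hlt
    · have := two_le hlt
      nlinarith
    · exact heq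
    · have := two_le hlt
      nlinarith
  subst hkj
  have ha : g.a = h.a := Subtype.ext (mul_right_cancel₀ hq.ne' (hk.trans hj.symm))
  have hb : ((g * q).b / 2 ^ k - (h * q).b / 2 ^ k : ℝ) = (g.b - h.b) / 2 ^ k := by
    rw [AffGroup.mul_b, AffGroup.mul_b, ha]
    ring
  have hz : (((g.b - h.b) / 2 ^ k : ℝ) : UnitAddCircle) = 0 := by
    rw [← hb, AddCircle.coe_sub, hkb, hjb, sub_self]
  obtain ⟨n, hn⟩ := (AddCircle.coe_eq_zero_iff _).1 hz
  rw [zsmul_eq_mul, mul_one, eq_div_iff (by positivity), ← hk] at hn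
  have hn0 : n = 0 := by
    have habs : |(n : ℝ)| < 1 := by
      have e : |(n : ℝ)| * (g.a * q.a) = |g.b - h.b| := by
        rw [← hn, abs_mul, abs_of_pos (mul_pos g.a.2 hq)]
      have := abs_sub g.b h.b
      by_contra! hc
      have hlow : 3 / 4 * (q.a : ℝ) ≤ g.a * q.a := by nlinarith
      have hmul : 1 * (g.a * q.a : ℝ) ≤ |(n : ℝ)| * (g.a * q.a) :=
        mul_le_mul_of_nonneg_right hc (mul_pos g.a.2 hq).le
      linarith
    rw [← Int.cast_abs] at habs
    exact Int.abs_lt_one_iff.1 (by exact_mod_cast habs)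
  rw [hn0, Int.cast_zero, zero_mul] at hn
  exact AffGroup.ext ha (by linarith)

/-- Arbitrarily small elements of `G` carry a tile of `T` into `tilingOf y`. By `frames_separated`
all sufficiently small ones coincide, so they are the identity. Thus the encoded tilings are the
only members of their inseparability classes. -/
theorem eq_tilingOf_of_inseparable {T : TileSet} {y : solenoid}
    (h : Inseparable T (tilingOf y)) : T = tilingOf y := by
  have hsub : ∀ K ∈ T.tiles, K ∈ (tilingOf y).tiles := by
    intro K hK
    obtain ⟨ρ, hρ, hm⟩ := TileSet.exists_meets K
    have hnear : ∀ ε : ℝ, 0 < ε → ∃ g : AffGroup,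
        dist (g • UpperHalfPlane.I) UpperHalfPlane.I < ε ∧
        tileImage g K ∈ (tilingOf y).tiles := by
      intro ε hε
      -- The radius has to see the moved tile `g K`, which meets the ball of radius `ρ + ε`.
      have hη : 0 < min ε (1 / (ρ + ε)) := lt_min hε (by positivity)
      obtain ⟨g, hg, hg'⟩ := TileSet.near_of_inseparable h hη
      refine ⟨g, hg.trans_le (min_le_left _ _), (hg' _ ((hm.tileImage g).mono ?_)).1 ?_⟩
      · have : ρ + ε ≤ 1 / min ε (1 / (ρ + ε)) := by
          rw [le_one_div (by positivity) hη]
          exact min_le_right _ _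
        linarith [hg.trans_le (min_le_left _ _)]
      · exact ⟨K, hK, rfl⟩
    obtain ⟨q, rfl⟩ : ∃ q, K = tileImage q prototile := by
      obtain ⟨g, -, f, -, hf⟩ := hnear 1 one_pos
      refine ⟨g⁻¹ * f, ?_⟩
      rw [tileImage_mul, ← hf, ← tileImage_mul, inv_mul_cancel, tileImage_one]
    simp only [← tileImage_mul, tileImage_mem_tilingOf] at hnear ⊢
    obtain ⟨ε, hε, hsep⟩ := frames_separated y q
    obtain ⟨g, hg, hgq⟩ := hnear ε hε
    suffices g = 1 by rwa [this, one_mul] at hgq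
    apply AffGroup.eq_one_of_smul_I
    -- If `g` moved `i`, an element moving `i` strictly less would also carry the tile into
    -- `tilingOf y`, and separation would make the two equal.
    by_contra hne
    obtain ⟨g', hg', hgq'⟩ := hnear (min ε (dist (g • UpperHalfPlane.I) UpperHalfPlane.I))
      (lt_min hε (dist_pos.2 hne))
    rw [hsep g' g (hg'.trans_le (min_le_left _ _)) hg hgq' hgq] at hg'
    exact absurd (hg'.trans_le (min_le_right _ _)) (lt_irrefl _)
  apply TileSet.ext
  -- Conversely, a tile of `tilingOf y` is a `g`-image of a tile of `T`, which by `hsub` lies in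
  -- `tilingOf y` as well; separation gives `g = 1`.
  refine Set.Subset.antisymm hsub ?_
  rintro _ ⟨f, hf, rfl⟩
  obtain ⟨ρ, hρ, hm⟩ := TileSet.exists_meets (tileImage f prototile)
  obtain ⟨ε, hε, hsep⟩ := frames_separated y f
  have hη : 0 < min ε (1 / ρ) := lt_min hε (by positivity)
  obtain ⟨g, hg, hg'⟩ := TileSet.near_of_inseparable h hη
  have hmem := (hg' _ (hm.mono (by rw [le_one_div hρ hη]; exact min_le_right _ _))).2
    (tileImage_mem_tilingOf.2 hf)
  rw [TileSet.mem_smul_tiles, ← tileImage_mul] at hmem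
  have hg1 : g⁻¹ = 1 := by
    refine hsep g⁻¹ 1 ?_ (by simpa using hε) (tileImage_mem_tilingOf.1 (hsub _ hmem))
      (by rwa [one_mul])
    rw [AffGroup.dist_inv_smul_I]
    exact hg.trans_le (min_le_left _ _)
  rwa [hg1, one_mul] at hmem

/-! ### Continuity of the encoding and identification of the hull -/

/-- A tile of scale `a` lies above height `a`, while the ball of radius `ρ` lies below height `exp
ρ`. -/
theorem level_lt_of_meets {g : AffGroup} {ρ : ℝ} (h : TileSet.Meets (tileImage g prototile) ρ) :
    (g.a : ℝ) < Real.exp ρ := by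
  obtain ⟨_, ⟨z, hz, rfl⟩, hzρ⟩ := h
  have hd := (UpperHalfPlane.dist_log_im_le (g • z) UpperHalfPlane.I).trans_lt
    (Metric.mem_ball.1 hzρ)
  rw [UpperHalfPlane.I_im, Real.log_one, Real.dist_eq, sub_zero] at hd
  have h1 := (le_abs_self _).trans_lt hd
  rw [Real.log_lt_iff_lt_exp (UpperHalfPlane.im_pos _), AffGroup.smul_im] at h1
  have h2 := one_le_im_of_mem_pentagon hz
  have h3 : (0 : ℝ) < g.a := g.a.2
  nlinarith

/-- A ball sees only rows up to some level `K`, and row `K` determines all lower rows. If `y'` is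
close to `y` at level `K`, a small translation of `tilingOf y` aligns row `K`, hence everything
visible. -/
theorem continuous_tilingOf : Continuous tilingOf := by
  rw [continuous_iff_continuousAt]
  intro y
  rw [ContinuousAt, (TileSet.nhds_basis_near _).tendsto_right_iff]
  intro ε hε
  obtain ⟨K, hK⟩ := pow_unbounded_of_one_lt (Real.exp (1 / ε)) one_lt_two
  have hc : Continuous fun s : ℝ => (AffGroup.translation s • UpperHalfPlane.I : ℍ) := by
    rw [UpperHalfPlane.isEmbedding_coe.continuous_iff]
    have : (UpperHalfPlane.coe ∘ fun s : ℝ => (AffGroup.translation s • UpperHalfPlane.I : ℍ))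
        = fun s : ℝ => (s : ℂ) + Complex.I := by
      funext s
      simp [AffGroup.smul_def, AffGroup.translation]
    rw [this]
    fun_prop
  have hV : {s : ℝ | dist (AffGroup.translation s • UpperHalfPlane.I) UpperHalfPlane.I < ε}
      ∈ 𝓝 (0 : ℝ) := by
    apply (isOpen_lt (hc.dist continuous_const) continuous_const).mem_nhds
    simpa [AffGroup.translation_zero] using hε
  have hW : (fun s : ℝ => ((s / 2 ^ (K : ℤ) : ℝ) : UnitAddCircle)) ''
      {s : ℝ | dist (AffGroup.translation s • UpperHalfPlane.I) UpperHalfPlane.I < ε}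
      ∈ 𝓝 (0 : UnitAddCircle) := by
    have hopen : IsOpenMap fun s : ℝ => ((s / 2 ^ (K : ℤ) : ℝ) : UnitAddCircle) :=
      QuotientAddGroup.isOpenMap_coe.comp
        (by
          simp only [div_eq_mul_inv]
          exact (Homeomorph.mulRight₀ ((2 ^ (K : ℤ) : ℝ)⁻¹) (by positivity)).isOpenMap)
    have := hopen.image_mem_nhds hV
    simpa using this
  have hcont : Continuous fun y' : solenoid => y'.1 K - y.1 K :=
    ((continuous_apply (K : ℤ)).comp continuous_subtype_val).sub continuous_const
  have hpre := hcont.continuousAt.preimage_mem_nhds (x := y) (by rw [sub_self]; exact hW)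
  filter_upwards [hpre] with y' hy'
  obtain ⟨s, hs, hsy⟩ := hy'
  refine ⟨AffGroup.translation s, hs, fun L hL => ?_⟩
  rw [translation_smul_tilingOf]
  have hrow : ∀ k : ℤ, k ≤ K → (solenoid.line s + y).1 k = y'.1 k := by
    intro k hk
    refine solenoid.apply_eq_of_le hk ?_
    change (solenoid.line s).1 K + y.1 K = y'.1 K
    rw [solenoid.line_apply]
    exact (eq_sub_iff_add_eq.1 hsy)
  have hlevel : ∀ (g : AffGroup) (k : ℤ), L = tileImage g prototile → (g.a : ℝ) = 2 ^ k →
      k ≤ K := by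
    rintro g k rfl hk
    have h1 := (level_lt_of_meets hL).trans hK
    rw [hk, ← zpow_natCast] at h1
    exact ((zpow_lt_zpow_iff_right₀ one_lt_two).1 h1).le
  constructor
  · rintro ⟨g, ⟨k, hk, hb⟩, hg⟩
    exact ⟨g, ⟨k, hk, by rw [hb, hrow k (hlevel g k hg hk)]⟩, hg⟩
  · rintro ⟨g, ⟨k, hk, hb⟩, hg⟩
    exact ⟨g, ⟨k, hk, by rw [hb, hrow k (hlevel g k hg hk)]⟩, hg⟩

/-- The image of the solenoid is compact. In an R1 space the closure of a compact set adds only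
points inseparable from it, and here there are none. -/
theorem closure_orbitN : closure orbitN = Set.range tilingOf := by
  have horbit : orbitN = tilingOf '' Set.range solenoid.line := by
    rw [← Set.range_comp]
    refine congrArg Set.range (funext fun s => ?_)
    rw [penrose_eq, translation_smul_tilingOf, add_zero]
    rfl
  apply Set.Subset.antisymm
  · have hclosed : closure (Set.range tilingOf) = Set.range tilingOf := by
      rw [(isCompact_range continuous_tilingOf).closure_eq_biUnion_inseparable]
      refine Set.Subset.antisymm ?_ (fun T hT => Set.mem_biUnion hT (Inseparable.refl T))
      intro T hT
      obtain ⟨_, ⟨y, rfl⟩, hy⟩ := Set.mem_iUnion₂.1 hT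
      exact ⟨y, (eq_tilingOf_of_inseparable (Inseparable.symm hy)).symm⟩
    rw [← hclosed, horbit]
    exact closure_mono (Set.image_subset_range _ _)
  · rw [horbit]
    exact continuous_tilingOf.range_subset_closure_image_dense solenoid.denseRange_line

/-! ### The hull as a homeomorphic copy of the solenoid -/

namespace HullN

instance : T2Space HullN := by
  have : R1Space HullN := inferInstanceAs (R1Space ↥(closure orbitN))
  have : T0Space HullN := by
    refine ⟨fun T T' h => Subtype.ext ?_⟩
    have h' : Inseparable T.1 T'.1 := h.map continuous_subtype_val
    obtain ⟨y, hy⟩ : T'.1 ∈ Set.range tilingOf := closure_orbitN ▸ T'.2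
    rw [← hy] at h' ⊢
    exact eq_tilingOf_of_inseparable h'
  infer_instance

/-- The encoding of the hull by the solenoid, as a bijection. -/
noncomputable def equivSolenoid : solenoid ≃ HullN :=
  Equiv.ofBijective
    (fun y => ⟨tilingOf y, closure_orbitN ▸ Set.mem_range_self y⟩)
    ⟨fun x y h => tilingOf_injective (congrArg Subtype.val h), fun T => by
      obtain ⟨y, hy⟩ : T.1 ∈ Set.range tilingOf := closure_orbitN ▸ T.2
      exact ⟨y, Subtype.ext hy⟩⟩

/-- The translation flow on the hull is the flow along a one-parameter subgroup of the solenoid. -/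
noncomputable def homeoSolenoid : solenoid ≃ₜ HullN :=
  Continuous.homeoOfEquivCompactToT2 (f := equivSolenoid)
    (Continuous.subtype_mk continuous_tilingOf _)

theorem vadd_homeoSolenoid (s : ℝ) (y : solenoid) :
    s +ᵥ homeoSolenoid y = homeoSolenoid (solenoid.line s + y) :=
  Subtype.ext (translation_smul_tilingOf s y)

instance : CompactSpace HullN := homeoSolenoid.compactSpace

instance : SecondCountableTopology HullN := homeoSolenoid.symm.secondCountableTopology

instance : ContinuousVAdd ℝ HullN := by
  refine ⟨?_⟩
  have h : (fun p : ℝ × HullN => p.1 +ᵥ p.2) = fun p : ℝ × HullN =>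
      homeoSolenoid (solenoid.line p.1 + homeoSolenoid.symm p.2) := by
    funext p
    rw [← vadd_homeoSolenoid, Homeomorph.apply_symm_apply]
  rw [h]
  have := solenoid.continuous_line
  fun_prop

theorem continuous_R : Continuous R :=
  Continuous.subtype_mk ((TileSet.continuous_smul _).comp continuous_subtype_val) _

theorem continuous_R_symm : Continuous R.symm :=
  Continuous.subtype_mk ((TileSet.continuous_smul _).comp continuous_subtype_val) _

end HullN

/-! ### The invariant probability measure on the hull -/

/-- Dominated convergence. It serves to pass from invariance at a dense or conull set of parameters
to invariance at all of them. -/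
theorem continuous_integral_comp {P X : Type*} [TopologicalSpace P] [FirstCountableTopology P]
    [TopologicalSpace X] [MeasurableSpace X] [BorelSpace X] (κ : Measure X) [IsFiniteMeasure κ]
    (f : BoundedContinuousFunction X ℝ) (a : P → X → X)
    (ha : Continuous (Function.uncurry a)) : Continuous fun p => ∫ x, f (a p x) ∂κ := by
  refine continuous_of_dominated (bound := fun _ => ‖f‖) (fun p => ?_) (fun p => ?_)
    (integrable_const _) ?_
  · exact (f.continuous.comp (ha.comp (Continuous.prodMk_right p))).aestronglyMeasurable
  · exact Filter.Eventually.of_forall fun x => f.norm_coe_le_norm _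
  · exact Filter.Eventually.of_forall fun x =>
      f.continuous.comp (ha.comp (Continuous.prodMk_left x))

/-- A finite measure on a group that is invariant under a dense set of translations is
invariant. -/
theorem isAddLeftInvariant_of_dense {A : Type*} [AddGroup A] [TopologicalSpace A]
    [IsTopologicalAddGroup A] [SecondCountableTopology A] [HasOuterApproxClosed A]
    [MeasurableSpace A] [BorelSpace A] (κ : Measure A) [IsFiniteMeasure κ] {D : Set A}
    (hD : Dense D) (h : ∀ d ∈ D, κ.map (d + ·) = κ) : κ.IsAddLeftInvariant := by
  refine ⟨fun g => ext_of_forall_integral_eq_of_IsFiniteMeasure fun f => ?_⟩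
  have hmap : ∀ d : A, ∫ x, f x ∂(κ.map (d + ·)) = ∫ x, f (d + x) ∂κ := fun d =>
    integral_map (continuous_const_add d).aemeasurable f.continuous.aestronglyMeasurable
  have hcont := continuous_integral_comp κ f (fun d x : A => d + x) continuous_add
  have heq : (fun d => ∫ x, f (d + x) ∂κ) = fun _ => ∫ x, f x ∂κ :=
    hcont.ext_on hD continuous_const fun d hd => by
      change ∫ x, f (d + x) ∂κ = ∫ x, f x ∂κ
      rw [← hmap, h d hd]
  rw [hmap]
  exact congrFun heq g

/-- The translation-invariant probability measure on the hull: the image of the Haar measure of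
the solenoid. -/
noncomputable def hullMeasure : Measure HullN :=
  (Measure.addHaarMeasure (⊤ : PositiveCompacts solenoid)).map HullN.homeoSolenoid

instance : IsProbabilityMeasure (Measure.addHaarMeasure (⊤ : PositiveCompacts solenoid)) :=
  ⟨Measure.addHaarMeasure_self⟩

instance : IsProbabilityMeasure hullMeasure :=
  Measure.isProbabilityMeasure_map HullN.homeoSolenoid.continuous.aemeasurable

theorem map_vadd_hullMeasure (s : ℝ) : hullMeasure.map (s +ᵥ ·) = hullMeasure := by
  have h1 : Measurable (s +ᵥ · : HullN → HullN) := (continuous_const_vadd s).measurable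
  have h2 : Measurable HullN.homeoSolenoid := HullN.homeoSolenoid.continuous.measurable
  have h3 : Measurable (solenoid.line s + · : solenoid → solenoid) := measurable_const_add _
  have hcomm : (s +ᵥ · : HullN → HullN) ∘ HullN.homeoSolenoid
      = HullN.homeoSolenoid ∘ (solenoid.line s + ·) :=
    funext fun y => HullN.vadd_homeoSolenoid s y
  rw [hullMeasure, Measure.map_map h1 h2, hcomm, ← Measure.map_map h2 h3, map_add_left_eq_self]

/-- Transported to the solenoid, `κ` is invariant under the dense `line`, hence under the whole
group, and Haar measure is unique. The total mass is left free because the result is also applied to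
slices of a measure. -/
theorem eq_smul_hullMeasure (κ : Measure HullN) [IsFiniteMeasure κ]
    (h : ∀ s : ℝ, κ.map (s +ᵥ ·) = κ) : κ = κ Set.univ • hullMeasure := by
  have h2 : Measurable HullN.homeoSolenoid := HullN.homeoSolenoid.continuous.measurable
  have h2' : Measurable HullN.homeoSolenoid.symm := HullN.homeoSolenoid.symm.continuous.measurable
  set ρ := κ.map HullN.homeoSolenoid.symm with hρ
  have hfin : IsFiniteMeasure ρ := Measure.isFiniteMeasure_map _ _
  have hκ : κ = ρ.map HullN.homeoSolenoid := by
    rw [hρ, Measure.map_map h2 h2', HullN.homeoSolenoid.self_comp_symm, Measure.map_id]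
  have hinv : ρ.IsAddLeftInvariant := by
    refine isAddLeftInvariant_of_dense ρ solenoid.denseRange_line ?_
    rintro _ ⟨s, rfl⟩
    have h1 : Measurable (s +ᵥ · : HullN → HullN) := (continuous_const_vadd s).measurable
    have hcomm : (solenoid.line s + ·) ∘ HullN.homeoSolenoid.symm
        = HullN.homeoSolenoid.symm ∘ (s +ᵥ · : HullN → HullN) := by
      funext T
      apply HullN.homeoSolenoid.injective
      simp [← HullN.vadd_homeoSolenoid]
    rw [hρ, Measure.map_map (measurable_const_add _) h2', hcomm, ← Measure.map_map h2' h1, h s]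
  obtain ⟨c, hsm⟩ : ∃ c : NNReal,
      ρ = c • Measure.addHaarMeasure (⊤ : PositiveCompacts solenoid) :=
    ⟨_, Measure.isAddLeftInvariant_eq_smul ρ _⟩
  have hκc : κ = c • hullMeasure := by
    rw [hκ, hsm, Measure.map_smul, hullMeasure]
  have hc : κ Set.univ = c := by
    rw [hκc]
    simp
  rw [hc]
  exact hκc

theorem isUniqueInvariantProbability_hullMeasure : IsUniqueInvariantProbability hullMeasure := by
  refine ⟨inferInstance, ⟨fun s A hA => ?_⟩, fun ν' hν' hinv => ?_⟩
  · rw [← Measure.map_apply (continuous_const_vadd s).measurable hA, map_vadd_hullMeasure]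
  · have h := eq_smul_hullMeasure ν' fun s => by
      ext A hA
      rw [Measure.map_apply (continuous_const_vadd s).measurable hA]
      exact hinv.measure_preimage_vadd s hA
    rwa [measure_univ, one_smul] at h

/-! ### Invariant measures on products -/

instance : IsTopologicalGroup PosReal where
  continuous_mul := by
    refine Continuous.subtype_mk (f := fun p : PosReal × PosReal => (p.1 : ℝ) * p.2) ?_ _
    fun_prop
  continuous_inv := by
    refine Continuous.subtype_mk (f := fun p : PosReal => (p : ℝ)⁻¹) ?_ _
    exact continuous_subtype_val.inv₀ fun p => p.2.ne'

instance : LocallyCompactSpace PosReal :=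
  (isOpen_lt continuous_const continuous_id : IsOpen {x : ℝ | 0 < x}).locallyCompactSpace

/-- A measure on `Y × H` that is invariant under the left translations of the group `H` is the
product of a measure on `Y` and a Haar measure. -/
theorem exists_eq_prod_haar {Y H : Type*} [MeasurableSpace Y] [Group H] [TopologicalSpace H]
    [IsTopologicalGroup H] [LocallyCompactSpace H] [SecondCountableTopology H]
    [MeasurableSpace H] [BorelSpace H] (m : Measure H) [m.IsHaarMeasure] (ρ : Measure (Y × H))
    [IsLocallyFiniteMeasure (ρ.map Prod.snd)]
    (hinv : ∀ a : H, ρ.map (Prod.map id (a * ·)) = ρ) :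
    ∃ κ : Measure Y, IsFiniteMeasure κ ∧ ρ = κ.prod m := by
  obtain ⟨K, hKc, hK1⟩ := exists_compact_mem_nhds (1 : H)
  obtain ⟨C, hCK, hCo, h1C⟩ := mem_nhds_iff.1 hK1
  have hC : MeasurableSet C := hCo.measurableSet
  have hm0 : m C ≠ 0 := (hCo.measure_pos m ⟨1, h1C⟩).ne'
  have hmt : m C ≠ ⊤ := ((measure_mono hCK).trans_lt hKc.measure_lt_top).ne
  -- For fixed `A`, the map `D ↦ ρ (A ×ˢ D)` is a locally finite left-invariant measure on `H`,
  -- hence a multiple of `m`.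
  have hslice : ∀ A : Set Y, MeasurableSet A → ∃ c : NNReal, ∀ D : Set H, MeasurableSet D →
      ρ (A ×ˢ D) = c * m D := by
    intro A hA
    set η := (ρ.restrict (A ×ˢ Set.univ)).map Prod.snd with hη
    have hηD : ∀ D, MeasurableSet D → η D = ρ (A ×ˢ D) := by
      intro D hD
      rw [hη, Measure.map_apply measurable_snd hD, Measure.restrict_apply (measurable_snd hD)]
      congr 1
      ext p
      simp [and_comm]
    have hle : η ≤ ρ.map Prod.snd := Measure.map_mono Measure.restrict_le_self measurable_snd
    have hfin : IsFiniteMeasureOnCompacts η :=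
      ⟨fun K hK => (hle K).trans_lt hK.measure_lt_top⟩
    have hηinv : η.IsMulLeftInvariant := by
      refine ⟨fun a => ?_⟩
      ext D hD
      rw [Measure.map_apply (measurable_const_mul a) hD, hηD _ (measurable_const_mul a hD), hηD D hD]
      conv_rhs => rw [← hinv a]
      rw [Measure.map_apply (measurable_id.prodMap (measurable_const_mul a)) (hA.prod hD)]
      rfl
    obtain ⟨c, hc⟩ : ∃ c : NNReal, η = c • m := ⟨_, Measure.isMulLeftInvariant_eq_smul η m⟩
    refine ⟨c, fun D hD => ?_⟩
    rw [← hηD D hD, hc]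
    rfl
  -- The multiple is read off on the test set `C`: open and nonempty, so `m C ≠ 0`; inside a compact
  -- set, so `m C ≠ ⊤`.
  set κ : Measure Y := (m C)⁻¹ • (ρ.restrict (Set.univ ×ˢ C)).map Prod.fst with hκ
  have hκA : ∀ A, MeasurableSet A → κ A = (m C)⁻¹ * ρ (A ×ˢ C) := by
    intro A hA
    rw [hκ, Measure.smul_apply, Measure.map_apply measurable_fst hA,
      Measure.restrict_apply (measurable_fst hA), smul_eq_mul]
    congr 2
    ext p
    simp
  have hfin : IsFiniteMeasure κ := by
    obtain ⟨c, hc⟩ := hslice Set.univ MeasurableSet.univ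
    refine ⟨?_⟩
    rw [hκA _ MeasurableSet.univ, hc C hC]
    exact ENNReal.mul_lt_top (ENNReal.inv_lt_top.2 (pos_iff_ne_zero.2 hm0))
      (ENNReal.mul_lt_top ENNReal.coe_lt_top hmt.lt_top)
  refine ⟨κ, hfin, (Measure.prod_eq fun A D hA hD => ?_).symm⟩
  obtain ⟨c, hc⟩ := hslice A hA
  rw [hκA A hA, hc C hC, hc D hD, mul_comm (c : ENNReal) (m C), ← mul_assoc,
    ENNReal.inv_mul_cancel hm0 hmt, one_mul]

/-- If `κ ⊗ m` is invariant under `(y, t) ↦ (y + b / t, t)`, then `κ` is invariant under the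
flow. -/
theorem map_eq_of_prod_invariant {Y : Type*} [TopologicalSpace Y] [SecondCountableTopology Y]
    [HasOuterApproxClosed Y] [MeasurableSpace Y] [BorelSpace Y] (κ : Measure Y)
    [IsFiniteMeasure κ] (m : Measure PosReal) [m.IsHaarMeasure] (φ : ℝ → Y → Y)
    (hφ : Continuous (Function.uncurry φ)) (b : ℝ)
    (hinv : (κ.prod m).map (fun p : Y × PosReal => (φ (b / p.2) p.1, p.2)) = κ.prod m) :
    κ.map (φ b) = κ := by
  have hdiv : Continuous fun t : PosReal => b / (t : ℝ) :=
    continuous_const.div continuous_subtype_val fun t => t.2.ne'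
  set ψ : Y × PosReal → Y × PosReal := fun p => (φ (b / p.2) p.1, p.2) with hψdef
  have hψ : Continuous ψ :=
    (hφ.comp ((hdiv.comp continuous_snd).prodMk continuous_fst)).prodMk continuous_snd
  have hφb : Continuous (φ b) := hφ.comp (Continuous.prodMk_right b)
  refine ext_of_forall_integral_eq_of_IsFiniteMeasure fun f => ?_
  rw [integral_map hφb.aemeasurable f.continuous.aestronglyMeasurable]
  have hF : Continuous fun s => ∫ y, f (φ s y) ∂κ := continuous_integral_comp κ f φ hφ
  have hG : Continuous fun t : PosReal => ∫ y, f (φ (b / t) y) ∂κ := hF.comp hdiv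
  have hbound : ∀ t : PosReal, ‖∫ y, f (φ (b / t) y) ∂κ‖ ≤ ‖f‖ * κ.real Set.univ := fun t =>
    norm_integral_le_of_norm_le_const (Filter.Eventually.of_forall fun y => f.norm_coe_le_norm _)
  -- The map `ψ` fixes the second coordinate, so it preserves the restriction to `Y × C` for every
  -- `C`; integrating over `Y × C` compares the two functions of `t` on `C`.
  have hae : (fun t : PosReal => ∫ y, f (φ (b / t) y) ∂κ) =ᵐ[m] fun _ => ∫ y, f y ∂κ := by
    refine ae_eq_of_forall_setIntegral_eq_of_sigmaFinite (fun C hC hCt => ?_)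
      (fun C hC hCt => integrableOn_const hCt.ne) (fun C hC hCt => ?_)
    · exact Measure.integrableOn_of_bounded hCt.ne hG.aestronglyMeasurable
        (Filter.Eventually.of_forall hbound)
    · have hfinC : IsFiniteMeasure (m.restrict C) := ⟨by simpa using hCt⟩
      have hmap : (κ.prod (m.restrict C)).map ψ = κ.prod (m.restrict C) := by
        have hpre : ψ ⁻¹' (Set.univ ×ˢ C) = Set.univ ×ˢ C := by
          ext p
          simp [hψdef]
        have hrestr : κ.prod (m.restrict C) = (κ.prod m).restrict (Set.univ ×ˢ C) := by
          rw [← Measure.prod_restrict, Measure.restrict_univ]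
        rw [hrestr]
        conv_lhs => rw [← hpre]
        rw [← Measure.restrict_map hψ.measurable (MeasurableSet.univ.prod hC), hinv]
      have hint : ∀ g : Y × PosReal → Y, Continuous g →
          Integrable (fun p => f (g p)) (κ.prod (m.restrict C)) := fun g hg =>
        Integrable.of_bound (f.continuous.comp hg).aestronglyMeasurable ‖f‖
          (Filter.Eventually.of_forall fun p => f.norm_coe_le_norm _)
      have h1 := integral_prod_symm _ (hint (fun p => (ψ p).1) (continuous_fst.comp hψ))
      have h2 := integral_prod_symm _ (hint Prod.fst continuous_fst)
      have h3 := integral_map (μ := κ.prod (m.restrict C)) hψ.aemeasurable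
        (f := fun p : Y × PosReal => f p.1)
        (f.continuous.comp continuous_fst).aestronglyMeasurable
      rw [hmap, h2, h1] at h3
      exact h3.symm
  -- Haar measure charges nonempty open sets, so continuous functions that agree almost everywhere
  -- agree everywhere. The value at `t = 1` is the claim for time `b`.
  have heq := (hG.ae_eq_iff_eq m continuous_const).1 hae
  have h1 := congrFun heq 1
  simpa using h1

namespace DoubleSuspension

variable {r : ℕ} (w : ℤ → Fin r)

/-! ### The projection onto the double suspension -/

theorem continuous_subshiftMap : Continuous (subshiftMap w) :=
  Continuous.subtype_mk ((shift r).continuous.comp continuous_subtype_val) _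

theorem continuous_subshiftMap_symm : Continuous (subshiftMap w).symm :=
  Continuous.subtype_mk ((shift r).symm.continuous.comp continuous_subtype_val) _

theorem continuous_suspMap : Continuous (suspMap w) :=
  HullN.continuous_R.prodMap ((continuous_subshiftMap w).prodMap (continuous_id.div_const _))

theorem continuous_suspMap_symm : Continuous (suspMap w).symm :=
  HullN.continuous_R_symm.prodMap
    ((continuous_subshiftMap_symm w).prodMap (continuous_id.mul continuous_const))

theorem continuous_suspMap_zpow (n : ℤ) : Continuous ⇑(suspMap w ^ n) := by
  induction n with
  | zero => exact continuous_id
  | succ n ih =>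
    rw [zpow_add_one, Equiv.Perm.coe_mul]
    exact ih.comp (continuous_suspMap w)
  | pred n ih =>
    rw [zpow_sub_one, Equiv.Perm.coe_mul]
    exact ih.comp (continuous_suspMap_symm w)

theorem suspMap_height (x : TotalSpace w) : ((suspMap w x).2.2 : ℝ) = x.2.2 / 2 := by
  change ((x.2.2 / ⟨2, two_pos⟩ : PosReal) : ℝ) = x.2.2 / 2
  simp [div_eq_mul_inv]

theorem suspMap_zpow_height (n : ℤ) (x : TotalSpace w) :
    (((suspMap w ^ n) x).2.2 : ℝ) = x.2.2 / 2 ^ n := by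
  induction n generalizing x with
  | zero => simp
  | succ n ih =>
    rw [zpow_add_one, Equiv.Perm.mul_apply, ih, suspMap_height, zpow_add_one₀ two_ne_zero]
    field_simp
  | pred n ih =>
    have h : (x.2.2 : ℝ) = ((suspMap w)⁻¹ x).2.2 / 2 := by
      rw [← suspMap_height]
      exact congrArg (fun y : TotalSpace w => (y.2.2 : ℝ)) ((suspMap w).apply_symm_apply x).symm
    rw [zpow_sub_one, Equiv.Perm.mul_apply, ih, zpow_sub_one₀ two_ne_zero, h]
    field_simp

theorem proj_eq_iff {x y : TotalSpace w} :
    proj w x = proj w y ↔ ∃ n : ℤ, (suspMap w ^ n) x = y :=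
  Quotient.eq (r := Equiv.Perm.SameCycle.setoid (suspMap w))

theorem continuous_proj : Continuous (proj w) := continuous_quotient_mk'

/-- The saturation of an open set is a union of preimages under the powers of a homeomorphism. -/
theorem isOpenMap_proj : IsOpenMap (proj w) := by
  intro U hU
  have hpre : proj w ⁻¹' (proj w '' U) = ⋃ n : ℤ, ⇑(suspMap w ^ n) ⁻¹' U := by
    ext x
    simp only [Set.mem_preimage, Set.mem_iUnion, Set.mem_image]
    constructor
    · rintro ⟨y, hy, hxy⟩
      obtain ⟨n, rfl⟩ := (proj_eq_iff w).1 hxy.symm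
      exact ⟨n, hy⟩
    · rintro ⟨n, hn⟩
      exact ⟨_, hn, ((proj_eq_iff w).2 ⟨n, rfl⟩).symm⟩
  have hq : IsQuotientMap (proj w) := isQuotientMap_quotient_mk'
  rw [← hq.isOpen_preimage, hpre]
  exact isOpen_iUnion fun n => hU.preimage (continuous_suspMap_zpow w n)

/-! ### Slabs, on which the projection is injective -/

/-- The points of the total space with height in `[c, 2c)`. -/
def slab (c : ℝ) : Set (TotalSpace w) := {x | c ≤ x.2.2 ∧ (x.2.2 : ℝ) < 2 * c}

/-- The points of the total space with height in `(c, 2c)`. -/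
def openSlab (c : ℝ) : Set (TotalSpace w) := {x | c < x.2.2 ∧ (x.2.2 : ℝ) < 2 * c}

theorem continuous_height : Continuous fun x : TotalSpace w => (x.2.2 : ℝ) := by fun_prop

theorem measurableSet_slab (c : ℝ) : MeasurableSet (slab w c) :=
  (measurableSet_le measurable_const (continuous_height w).measurable).inter
    (measurableSet_lt (continuous_height w).measurable measurable_const)

theorem isOpen_openSlab (c : ℝ) : IsOpen (openSlab w c) :=
  (isOpen_lt continuous_const (continuous_height w)).inter
    (isOpen_lt (continuous_height w) continuous_const)

theorem openSlab_subset_slab (c : ℝ) : openSlab w c ⊆ slab w c := fun _ hx => ⟨hx.1.le, hx.2⟩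

/-- The `n`-th power of `suspMap` divides the height by `2 ^ n`, so two points of one orbit in the
slab have `n = 0`. -/
theorem injOn_proj_slab (c : ℝ) : Set.InjOn (proj w) (slab w c) := by
  rintro x ⟨hx1, hx2⟩ y ⟨hy1, hy2⟩ hxy
  obtain ⟨n, rfl⟩ := (proj_eq_iff w).1 hxy
  rw [suspMap_zpow_height] at hy1 hy2
  have hp : (0 : ℝ) < 2 ^ n := by positivity
  rw [le_div_iff₀ hp] at hy1
  rw [div_lt_iff₀ hp] at hy2
  have hx0 : (0 : ℝ) < x.2.2 := x.2.2.2
  have hn1 : n < 1 := by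
    by_contra! h
    have : (2 : ℝ) ^ (1 : ℤ) ≤ 2 ^ n := zpow_le_zpow_right₀ one_le_two h
    rw [zpow_one] at this
    nlinarith
  have hn2 : -1 < n := by
    by_contra! h
    have : (2 : ℝ) ^ n ≤ 2 ^ (-1 : ℤ) := zpow_le_zpow_right₀ one_le_two h
    rw [zpow_neg_one] at this
    nlinarith
  obtain rfl : n = 0 := by omega
  simp

theorem isOpenEmbedding_proj_openSlab (c : ℝ) :
    IsOpenEmbedding ((openSlab w c).domRestrict (proj w)) := by
  refine IsOpenEmbedding.of_continuous_injective_isOpenMap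
    ((continuous_proj w).comp continuous_subtype_val) ?_ ?_
  · exact Set.injOn_iff_injective.1 ((injOn_proj_slab w c).mono (openSlab_subset_slab w c))
  · exact (isOpenMap_proj w).comp (isOpen_openSlab w c).isOpenMap_subtype_val

theorem measurable_proj : Measurable (proj w) := (continuous_proj w).measurable

/-- On an open slab the projection is an open embedding, which carries Borel sets to Borel sets.
Countably many slabs suffice: a rational `q` between half the height of a point and its height puts
the point in `openSlab w q`. -/
theorem measurableSet_image_proj {A : Set (TotalSpace w)} (hA : MeasurableSet A) :
    MeasurableSet (proj w '' A) := by
  have hcover : A = ⋃ q : ℚ, A ∩ openSlab w q := by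
    rw [← Set.inter_iUnion, Set.left_eq_inter]
    intro x _
    have hx0 : (0 : ℝ) < x.2.2 := x.2.2.2
    obtain ⟨q, hq1, hq2⟩ := exists_rat_btwn (show (x.2.2 : ℝ) / 2 < x.2.2 by linarith)
    exact Set.mem_iUnion.2 ⟨q, hq2, by linarith⟩
  rw [hcover, Set.image_iUnion]
  refine MeasurableSet.iUnion fun q => ?_
  have h := (isOpenEmbedding_proj_openSlab w q).measurableEmbedding.measurableSet_image'
    (measurable_subtype_coe hA)
  have himg : (openSlab w q).domRestrict (proj w) '' (Subtype.val ⁻¹' A)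
      = proj w '' (A ∩ openSlab w q) := by
    change (proj w ∘ Subtype.val) '' (Subtype.val ⁻¹' A) = _
    rw [Set.image_comp, Subtype.image_preimage_coe, Set.inter_comm]
  rwa [← himg]

theorem measurableEmbedding_proj_slab (c : ℝ) :
    MeasurableEmbedding ((slab w c).domRestrict (proj w)) where
  injective := Set.injOn_iff_injective.1 (injOn_proj_slab w c)
  measurable := (measurable_proj w).comp measurable_subtype_coe
  measurableSet_image' s hs := by
    change MeasurableSet ((proj w ∘ Subtype.val) '' s)
    rw [Set.image_comp]
    exact measurableSet_image_proj w ((measurableSet_slab w c).subtype_image hs)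

/-! ### Lifting measures to the total space -/

/-- The lift of a measure on the double suspension to an invariant measure on the total space. -/
noncomputable def lift (θ : Measure (DoubleSuspension w)) : Measure (TotalSpace w) :=
  Measure.sum fun n : ℤ => (θ.comap ((slab w (2 ^ n)).domRestrict (proj w))).map Subtype.val

theorem iUnion_inter_slab (A : Set (TotalSpace w)) : ⋃ n : ℤ, A ∩ slab w (2 ^ n) = A := by
  rw [← Set.inter_iUnion, Set.inter_eq_left]
  intro x _
  obtain ⟨n, hn1, hn2⟩ := exists_mem_Ico_zpow x.2.2.2 one_lt_two
  rw [zpow_add_one₀ two_ne_zero, mul_comm] at hn2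
  exact Set.mem_iUnion.2 ⟨n, hn1, hn2⟩

theorem pairwise_disjoint_slab (A : Set (TotalSpace w)) :
    Pairwise fun i j : ℤ => Disjoint (A ∩ slab w (2 ^ i)) (A ∩ slab w (2 ^ j)) := by
  have key : ∀ i j : ℤ, i < j → Disjoint (slab w (2 ^ i)) (slab w (2 ^ j)) := by
    intro i j hij
    rw [Set.disjoint_left]
    rintro x ⟨-, hi⟩ ⟨hj, -⟩
    have h : (2 : ℝ) ^ (i + 1) ≤ 2 ^ j := zpow_le_zpow_right₀ one_le_two hij
    rw [zpow_add_one₀ two_ne_zero] at h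
    linarith
  intro i j hij
  refine Disjoint.mono Set.inter_subset_right Set.inter_subset_right ?_
  rcases lt_or_gt_of_ne hij with h | h
  · exact key i j h
  · exact (key j i h).symm

theorem lift_apply (θ : Measure (DoubleSuspension w)) {A : Set (TotalSpace w)}
    (hA : MeasurableSet A) : lift w θ A = ∑' n : ℤ, θ (proj w '' (A ∩ slab w (2 ^ n))) := by
  rw [lift, Measure.sum_apply _ hA]
  refine tsum_congr fun n => ?_
  rw [Measure.map_apply measurable_subtype_coe hA,
    (measurableEmbedding_proj_slab w _).comap_apply]
  change θ ((proj w ∘ Subtype.val) '' (Subtype.val ⁻¹' A)) = _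
  rw [Set.image_comp, Subtype.image_preimage_coe, Set.inter_comm]

/-- This formula frees `lift` from the dyadic partition used to define it: the pieces of `A` have
disjoint images as soon as the projection is injective on `A`. -/
theorem lift_apply_of_injOn (θ : Measure (DoubleSuspension w)) {A : Set (TotalSpace w)}
    (hA : MeasurableSet A) (hinj : Set.InjOn (proj w) A) : lift w θ A = θ (proj w '' A) := by
  rw [lift_apply w θ hA, ← measure_iUnion, ← Set.image_iUnion, iUnion_inter_slab]
  · intro i j hij
    exact Set.disjoint_image_image (fun x hx y hy hxy =>
      (pairwise_disjoint_slab w A hij).ne_of_mem hx hy (hinj hx.1 hy.1 hxy))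
  · exact fun n => measurableSet_image_proj w (hA.inter (measurableSet_slab w _))

/-- Cutting `A` along slabs reduces to sets on which the projection is injective, where `lift` is
computed by `θ`. It is used both for `suspMap` and for the action of `G`. -/
theorem map_lift_eq (θ : Measure (DoubleSuspension w)) {f : TotalSpace w → TotalSpace w}
    (hf : Measurable f)
    (hinj : ∀ A, Set.InjOn (proj w) A → Set.InjOn (proj w) (f ⁻¹' A))
    (hθ : ∀ A, MeasurableSet A → θ (proj w '' (f ⁻¹' A)) = θ (proj w '' A)) :
    (lift w θ).map f = lift w θ := by
  ext A hA
  have hmeas : ∀ n : ℤ, MeasurableSet (A ∩ slab w (2 ^ n)) :=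
    fun n => hA.inter (measurableSet_slab w _)
  rw [← iUnion_inter_slab w A, measure_iUnion (pairwise_disjoint_slab w A) hmeas,
    measure_iUnion (pairwise_disjoint_slab w A) hmeas]
  refine tsum_congr fun n => ?_
  have hi : Set.InjOn (proj w) (A ∩ slab w (2 ^ n)) :=
    (injOn_proj_slab w _).mono Set.inter_subset_right
  rw [Measure.map_apply hf (hmeas n), lift_apply_of_injOn w θ (hf (hmeas n)) (hinj _ hi),
    lift_apply_of_injOn w θ (hmeas n) hi, hθ _ (hmeas n)]

theorem map_suspMap_lift (θ : Measure (DoubleSuspension w)) :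
    (lift w θ).map (suspMap w) = lift w θ := by
  have hproj : ∀ x, proj w (suspMap w x) = proj w x := fun x =>
    ((proj_eq_iff w).2 ⟨1, by rw [zpow_one]⟩).symm
  refine map_lift_eq w θ (continuous_suspMap w).measurable (fun A hA x hx y hy hxy => ?_)
    (fun A _ => ?_)
  · exact (suspMap w).injective (hA hx hy (by rw [hproj, hproj, hxy]))
  · congr 1
    ext d
    constructor
    · rintro ⟨x, hx, rfl⟩
      exact ⟨_, hx, hproj x⟩
    · rintro ⟨x, hx, rfl⟩
      refine ⟨(suspMap w).symm x, by simpa using hx, ?_⟩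
      rw [← hproj, Equiv.apply_symm_apply]

theorem continuous_totalAct (g : AffGroup) : Continuous (totalAct w g) := by
  have h1 : Continuous fun x : TotalSpace w => g.b / ((g.a : ℝ) * x.2.2) :=
    continuous_const.div (continuous_const.mul (continuous_height w))
      fun x => (mul_pos g.a.2 x.2.2.2).ne'
  exact (h1.vadd continuous_fst).prodMk ((continuous_fst.comp continuous_snd).prodMk
    (continuous_const.mul (continuous_snd.comp continuous_snd)))

theorem map_totalAct_lift (θ : Measure (DoubleSuspension w))
    [SMulInvariantMeasure AffGroup (DoubleSuspension w) θ] (g : AffGroup) :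
    (lift w θ).map (totalAct w g) = lift w θ := by
  have hinv : ∀ x, totalAct w g⁻¹ (totalAct w g x) = x := fun x => by
    rw [← totalAct_mul, inv_mul_cancel, totalAct_one]
  have hinv' : ∀ x, totalAct w g (totalAct w g⁻¹ x) = x := fun x => by
    rw [← totalAct_mul, mul_inv_cancel, totalAct_one]
  refine map_lift_eq w θ (continuous_totalAct w g).measurable (fun A hA x hx y hy hxy => ?_)
    (fun A hA => ?_)
  · have h := hA hx hy (by rw [← smul_proj, ← smul_proj, hxy])
    rw [← hinv x, h, hinv]
  · rw [← SMulInvariantMeasure.measure_preimage_smul (μ := θ) g (measurableSet_image_proj w hA)]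
    congr 1
    ext d
    constructor
    · rintro ⟨x, hx, rfl⟩
      exact ⟨_, hx, (smul_proj w g x).symm⟩
    · rintro ⟨x, hx, hxd⟩
      refine ⟨totalAct w g⁻¹ x, by rwa [Set.mem_preimage, hinv'], ?_⟩
      rw [← smul_proj, hxd, inv_smul_smul]

theorem isLocallyImage_lift (θ : Measure (DoubleSuspension w)) :
    IsLocallyImage w θ (lift w θ) := by
  intro x
  have hx0 : (0 : ℝ) < x.2.2 := x.2.2.2
  -- The height `h` of `x` lies strictly between `2h/3` and `4h/3`.
  refine ⟨openSlab w (2 / 3 * x.2.2), isOpen_openSlab w _, ⟨by linarith, by linarith⟩,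
    isOpenEmbedding_proj_openSlab w _, ?_⟩
  set U := openSlab w (2 / 3 * x.2.2)
  have hU : MeasurableSet U := (isOpen_openSlab w _).measurableSet
  ext E hE
  rw [Measure.restrict_apply hE, Measure.map_apply (measurable_proj w) hE,
    Measure.restrict_apply (measurable_proj w hE),
    lift_apply_of_injOn w θ ((measurable_proj w hE).inter hU)
      ((injOn_proj_slab w _).mono (Set.inter_subset_right.trans (openSlab_subset_slab w _))),
    Set.image_preimage_inter]

/-! ### Invariant measures on the double suspension -/

/-- Elements with `b = 0` split off the Haar factor, elements with `a = 1` make the remaining factor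
flow-invariant, and uniqueness of the invariant measure on the hull splits that factor. -/
theorem exists_lift_eq_prod (θ : Measure (DoubleSuspension w)) [IsFiniteMeasure θ]
    [SMulInvariantMeasure AffGroup (DoubleSuspension w) θ] (m : Measure PosReal)
    [m.IsHaarMeasure] : ∃ μ : Measure (Subshift w), IsFiniteMeasure μ ∧
      lift w θ = hullMeasure.prod (μ.prod m) := by
  let e : (HullN × Subshift w) × PosReal ≃ᵐ TotalSpace w := MeasurableEquiv.prodAssoc
  have hconj : ∀ (g : AffGroup) (f : (HullN × Subshift w) × PosReal →
      (HullN × Subshift w) × PosReal), (∀ p, f p = e.symm (totalAct w g (e p))) →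
      ((lift w θ).map e.symm).map f = (lift w θ).map e.symm := by
    intro g f hf
    have hg := (continuous_totalAct w g).measurable
    have hfm : Measurable f := by
      rw [funext hf]
      exact e.symm.measurable.comp (hg.comp e.measurable)
    rw [Measure.map_map hfm e.symm.measurable]
    have : f ∘ e.symm = e.symm ∘ totalAct w g := by
      funext x
      simp [hf]
    rw [this, ← Measure.map_map e.symm.measurable hg, map_totalAct_lift]
  -- This is where finiteness of `θ` enters: an open slab embeds in the double suspension, so its
  -- lifted mass is at most that of `θ`.
  have hloc : IsLocallyFiniteMeasure (((lift w θ).map e.symm).map Prod.snd) := by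
    refine ⟨fun t => ?_⟩
    have ht0 : (0 : ℝ) < t := t.2
    set V : Set PosReal := {s | 2 / 3 * (t : ℝ) < s ∧ (s : ℝ) < 2 * (2 / 3 * t)}
    have hVo : IsOpen V := (isOpen_lt continuous_const continuous_subtype_val).inter
      (isOpen_lt continuous_subtype_val continuous_const)
    refine ⟨V, hVo.mem_nhds ⟨by linarith, by linarith⟩, ?_⟩
    rw [Measure.map_apply measurable_snd hVo.measurableSet,
      Measure.map_apply e.symm.measurable (measurable_snd hVo.measurableSet)]
    have hpre : e.symm ⁻¹' (Prod.snd ⁻¹' V) = openSlab w (2 / 3 * t) := rfl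
    rw [hpre, lift_apply_of_injOn w θ (isOpen_openSlab w _).measurableSet
      ((injOn_proj_slab w _).mono (openSlab_subset_slab w _))]
    exact measure_lt_top θ _
  obtain ⟨κ, hκfin, hκ⟩ := exists_eq_prod_haar m ((lift w θ).map e.symm) fun a =>
    hconj ⟨a, 0⟩ _ fun p => by
      simp [Prod.map_def, totalAct, e, MeasurableEquiv.prodAssoc, Equiv.prodAssoc]
  have hflow : ∀ s : ℝ, κ.map (fun p : HullN × Subshift w => (s +ᵥ p.1, p.2)) = κ := by
    intro s
    refine map_eq_of_prod_invariant κ m (fun s p => (s +ᵥ p.1, p.2)) ?_ s ?_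
    · exact (continuous_fst.vadd (continuous_fst.comp continuous_snd)).prodMk
        (continuous_snd.comp continuous_snd)
    · rw [← hκ]
      refine hconj ⟨1, s⟩ _ fun p => ?_
      simp [totalAct, e, MeasurableEquiv.prodAssoc, Equiv.prodAssoc]
  set μ := κ.map Prod.snd with hμ
  have hμfin : IsFiniteMeasure μ := Measure.isFiniteMeasure_map _ _
  have hprod : hullMeasure.prod μ = κ := by
    refine Measure.prod_eq fun A B hA hB => ?_
    -- The slice over `B` is flow-invariant of total mass `μ B`, hence equals `μ B • hullMeasure`.
    set κB := (κ.restrict (Set.univ ×ˢ B)).map Prod.fst with hκB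
    have hκBA : ∀ A, MeasurableSet A → κB A = κ (A ×ˢ B) := by
      intro A hA
      rw [hκB, Measure.map_apply measurable_fst hA, Measure.restrict_apply (measurable_fst hA)]
      congr 1
      ext p
      simp
    have hBfin : IsFiniteMeasure κB := Measure.isFiniteMeasure_map _ _
    have hBinv : ∀ s : ℝ, κB.map (s +ᵥ ·) = κB := by
      intro s
      have hs : Measurable (s +ᵥ · : HullN → HullN) := (continuous_const_vadd s).measurable
      ext A hA
      rw [Measure.map_apply hs hA, hκBA _ (hs hA), hκBA A hA]
      conv_rhs => rw [← hflow s]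
      have hmeas : Measurable fun p : HullN × Subshift w => (s +ᵥ p.1, p.2) :=
        (hs.comp measurable_fst).prodMk measurable_snd
      rw [Measure.map_apply hmeas (hA.prod hB)]
      rfl
    rw [← hκBA A hA, eq_smul_hullMeasure κB hBinv, Measure.smul_apply, smul_eq_mul,
      hκBA _ MeasurableSet.univ, hμ, Measure.map_apply measurable_snd hB, mul_comm,
      Set.univ_prod]
  refine ⟨μ, hμfin, ?_⟩
  have hassoc := Measure.prodAssoc_prod (μ := hullMeasure) (ν := μ) (τ := m)
  rw [← hassoc, hprod, ← hκ]
  change _ = ((lift w θ).map e.symm).map e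
  rw [Measure.map_map e.measurable e.symm.measurable, e.self_comp_symm, Measure.map_id]

/-- Testing invariance on `univ × B × K` isolates the shift: the hull contributes mass one, and
halving the height does not change `m K`, which is positive and finite and so cancels. -/
theorem measurePreserving_subshiftMap_of_prod {m : Measure PosReal} [m.IsHaarMeasure]
    {μ : Measure (Subshift w)} [IsFiniteMeasure μ]
    (h : (hullMeasure.prod (μ.prod m)).map (suspMap w) = hullMeasure.prod (μ.prod m)) :
    MeasurePreserving (subshiftMap w) μ μ := by
  have hσ : Measurable (subshiftMap w) := (continuous_subshiftMap w).measurable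
  refine ⟨hσ, ?_⟩
  ext B hB
  rw [Measure.map_apply hσ hB]
  obtain ⟨K, hKc, hK1⟩ := exists_compact_mem_nhds (1 : PosReal)
  have hK : MeasurableSet K := hKc.isClosed.measurableSet
  have hm0 : m K ≠ 0 := (Measure.measure_pos_of_mem_nhds m hK1).ne'
  have hmt : m K ≠ ⊤ := hKc.measure_lt_top.ne
  have hset := DFunLike.congr_fun h (Set.univ ×ˢ (B ×ˢ K))
  rw [Measure.map_apply (continuous_suspMap w).measurable
    (MeasurableSet.univ.prod (hB.prod hK))] at hset
  have hpre : suspMap w ⁻¹' (Set.univ ×ˢ (B ×ˢ K)) = Set.univ ×ˢ ((subshiftMap w ⁻¹' B) ×ˢ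
      ((· / (⟨2, two_pos⟩ : PosReal)) ⁻¹' K)) := by
    ext x
    simp only [Set.mem_preimage, Set.mem_prod, Set.mem_univ, true_and]
    rfl
  have hdiv : m ((· / (⟨2, two_pos⟩ : PosReal)) ⁻¹' K) = m K := by
    simp only [div_eq_mul_inv]
    exact measure_preimage_mul_right m _ K
  rw [hpre, Measure.prod_prod, Measure.prod_prod, Measure.prod_prod, Measure.prod_prod, hdiv,
    measure_univ, one_mul, one_mul] at hset
  exact (ENNReal.mul_left_inj hm0 hmt).1 hset

end DoubleSuspension

end HypPenrose

/-! ### Conclusion -/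

theorem mainTheorem8 (r : ℕ) (w : ℤ → Fin r)
    (m : MeasureTheory.Measure HypPenrose.PosReal) (hm : m.IsHaarMeasure) :
    ∃ ν : MeasureTheory.Measure HypPenrose.HullN,
      HypPenrose.IsUniqueInvariantProbability ν ∧
      ∀ θ : MeasureTheory.Measure (HypPenrose.DoubleSuspension w),
        MeasureTheory.IsFiniteMeasure θ →
        MeasureTheory.SMulInvariantMeasure HypPenrose.AffGroup
          (HypPenrose.DoubleSuspension w) θ →
        ∃ μ : MeasureTheory.Measure (HypPenrose.Subshift w),
          MeasureTheory.IsFiniteMeasure μ ∧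
          MeasureTheory.MeasurePreserving (HypPenrose.subshiftMap w) μ μ ∧
          HypPenrose.DoubleSuspension.IsLocallyImage w θ (ν.prod (μ.prod m)) := by
  refine ⟨HypPenrose.hullMeasure, HypPenrose.isUniqueInvariantProbability_hullMeasure,
    fun θ hθ hinv => ?_⟩
  obtain ⟨μ, hμ, hlift⟩ := HypPenrose.DoubleSuspension.exists_lift_eq_prod w θ m
  refine ⟨μ, hμ, ?_, ?_⟩
  · apply HypPenrose.DoubleSuspension.measurePreserving_subshiftMap_of_prod w (m := m)
    rw [← hlift, HypPenrose.DoubleSuspension.map_suspMap_lift]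
  · rw [← hlift]
    exact HypPenrose.DoubleSuspension.isLocallyImage_lift w θ
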